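/- Let $X\neq\{0\}$ be a real or complex Banach space with scalar field $\mathbb K$, let $\mathbb T=\{\lambda\in\mathbb K:|\lambda|=1\}$, and for a Banach space $Y$ put $\Pi(Y)=\{(y^*,y)\in S_{Y^*}\times S_Y : y^*(y)=1\}$. For a bounded linear operator $T$ on $X$ let $v(T)=\sup\{|x^*(Tx)|:(x^*,x)\in\Pi(X)\}$ be its numerical radius, and let $n(X)=\inf\{v(T):\|T\|=1\}$ be the numerical index of $X$. Let $\mathcal L_v(X)$ be the space of bounded linear operators on $X$ with the norm $v$ (which is a norm equivalent to the operator norm if $n(X)>0$), and let $\mathcal K_v(X)$ be its subspace of compact operators. A closed subspace $J$ of a Banach space $E$ is an M-ideal in $E$ if $E^*=J^*\oplus_1J^\perp$, i.e. if the annihilator $J^\perp$ is the range of a linear projection $P$ on $E^*$ with $\|\psi\|=\|P\psi\|+\|\psi-P\psi\|$ for all $\psi\in E^*$. Write $x^*\otimes x$ for the functional $T\mapsto x^*(Tx)$ on $\mathcal L_v(X)$, and $x^{**}\otimes x^*$ for the functional $K\mapsto x^{**}(K^*x^*)$ on $\mathcal K_v(X)$. Let $B_Z$ be the closed unit ball of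 a space $Z$ and $\operatorname{Ext}(B_Z)$ its set of extreme points. If $n(X)>0$ and $\mathcal K_v(X)$ is an M-ideal in $\mathcal L_v(X)$, then 1. $\operatorname{Ext}(B_{\mathcal L_v(X)^*})\subset\overline{\{\lambda\, x^*\otimes x:(x^*,x)\in\Pi(X),\ \lambda\in\mathbb T\}}^{\,w^*}$, and 2. $\operatorname{Ext}(B_{\mathcal K_v(X)^*})\subset\{\lambda\, x^{**}\otimes x^*:(x^{**},x^*)\in\Pi(X^*),\ \lambda\in\mathbb T\}$. -/

import Mathlib

open Set

noncomputable section

namespace NumRad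

variable (𝕜 : Type*) [RCLike 𝕜] (X : Type*) [NormedAddCommGroup X] [NormedSpace 𝕜 X]

/-- `Π(X)`: the pairs `(x*, x)` of norm-one elements of `X* × X` with `x*(x) = 1`. -/
def dualityPairs : Set (StrongDual 𝕜 X × X) :=
  {p | ‖p.1‖ = 1 ∧ ‖p.2‖ = 1 ∧ p.1 p.2 = 1}

variable {𝕜 X}

/-- The numerical radius `v(T) = sup {|x*(T x)| : (x*, x) ∈ Π(X)}`. -/
def numericalRadius (T : X →L[𝕜] X) : ℝ :=
  sSup ((fun p : StrongDual 𝕜 X × X => ‖p.1 (T p.2)‖) '' dualityPairs 𝕜 X)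

theorem norm_apply_le_opNorm (T : X →L[𝕜] X) {p : StrongDual 𝕜 X × X}
    (hp : p ∈ dualityPairs 𝕜 X) : ‖p.1 (T p.2)‖ ≤ ‖T‖ := by
  obtain ⟨h1, h2, -⟩ := hp
  calc ‖p.1 (T p.2)‖ ≤ ‖p.1‖ * ‖T p.2‖ := p.1.le_opNorm _
    _ ≤ ‖p.1‖ * (‖T‖ * ‖p.2‖) := by gcongr; exact T.le_opNorm _
    _ = ‖T‖ := by rw [h1, h2]; ring

theorem norm_apply_le_numericalRadius (T : X →L[𝕜] X) {p : StrongDual 𝕜 X × X}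
    (hp : p ∈ dualityPairs 𝕜 X) : ‖p.1 (T p.2)‖ ≤ numericalRadius T := by
  refine le_csSup ⟨‖T‖, ?_⟩ (mem_image_of_mem _ hp)
  rintro _ ⟨q, hq, rfl⟩
  exact norm_apply_le_opNorm T hq

theorem numericalRadius_nonneg (T : X →L[𝕜] X) : 0 ≤ numericalRadius T := by
  refine Real.sSup_nonneg ?_
  rintro _ ⟨q, -, rfl⟩
  exact norm_nonneg _

variable (𝕜 X)

/-- The numerical radius as a seminorm on the bounded operators on `X`. -/
def numericalRadiusSeminorm : Seminorm 𝕜 (X →L[𝕜] X) :=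
  Seminorm.ofSMulLE numericalRadius
    (by
      refine le_antisymm (Real.sSup_le ?_ le_rfl) (numericalRadius_nonneg _)
      rintro _ ⟨q, -, rfl⟩
      simp)
    (fun S T => by
      refine Real.sSup_le ?_ (add_nonneg (numericalRadius_nonneg S) (numericalRadius_nonneg T))
      rintro _ ⟨q, hq, rfl⟩
      simp only [add_apply, map_add]
      exact (norm_add_le _ _).trans
        (add_le_add (norm_apply_le_numericalRadius S hq) (norm_apply_le_numericalRadius T hq)))
    (fun c T => by
      refine Real.sSup_le ?_ (mul_nonneg (norm_nonneg c) (numericalRadius_nonneg T))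
      rintro _ ⟨q, hq, rfl⟩
      simp only [smul_apply, map_smul, norm_smul]
      exact mul_le_mul_of_nonneg_left (norm_apply_le_numericalRadius T hq) (norm_nonneg c))

/-- The numerical index `n(X) = inf {v(T) : ‖T‖ = 1}` (for `X ≠ 0` the set is nonempty). -/
def numericalIndex : ℝ :=
  sInf (numericalRadius '' {T : X →L[𝕜] X | ‖T‖ = 1})

/-- `L_v(X)`: a copy of the space of bounded operators on `X`, which will be normed by the
numerical radius instead of the operator norm. (In general `v` is a seminorm; it is a norm,
equivalent to the operator norm, if `n(X) > 0`.) -/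
def Lv : Type _ := X →L[𝕜] X

instance : AddCommGroup (Lv 𝕜 X) := inferInstanceAs (AddCommGroup (X →L[𝕜] X))

instance : Module 𝕜 (Lv 𝕜 X) := inferInstanceAs (Module 𝕜 (X →L[𝕜] X))

/-- The identity map from `L_v(X)` to the space of bounded operators. -/
def toOp : Lv 𝕜 X ≃ₗ[𝕜] (X →L[𝕜] X) := LinearEquiv.refl 𝕜 (X →L[𝕜] X)

instance : SeminormedAddCommGroup (Lv 𝕜 X) :=
  ((numericalRadiusSeminorm 𝕜 X).comp
    (toOp 𝕜 X).toLinearMap).toAddGroupSeminorm.toSeminormedAddCommGroup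

theorem norm_Lv (T : Lv 𝕜 X) : ‖T‖ = numericalRadius (toOp 𝕜 X T) := rfl

instance : NormedSpace 𝕜 (Lv 𝕜 X) where
  norm_smul_le c T := le_of_eq (map_smul_eq_mul ((numericalRadiusSeminorm 𝕜 X).comp
    (toOp 𝕜 X).toLinearMap) c T)

/-- `K_v(X)`: the subspace of compact operators of `L_v(X)`, with the norm of `L_v(X)`. -/
def Kv : Submodule 𝕜 (Lv 𝕜 X) :=
  (compactOperator (RingHom.id 𝕜) X X).comap (toOp 𝕜 X).toLinearMap

variable {𝕜 X}

/-- The functional `x* ⊗ x : T ↦ x*(T x)` on `L_v(X)`. -/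
def tensorL (f : StrongDual 𝕜 X) (x : X) : Lv 𝕜 X →ₗ[𝕜] 𝕜 where
  toFun T := f (toOp 𝕜 X T x)
  map_add' S T := by simp
  map_smul' c T := by simp

/-- The functional `x** ⊗ x* : K ↦ x**(K* x*)` on `K_v(X)`, where `K* x* = x* ∘ K`. -/
def tensorK (φ : StrongDual 𝕜 (StrongDual 𝕜 X)) (f : StrongDual 𝕜 X) : Kv 𝕜 X →ₗ[𝕜] 𝕜 where
  toFun K := φ (f.comp (toOp 𝕜 X (K : Lv 𝕜 X)))
  map_add' S T := by simp
  map_smul' c T := by simp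

/-- `J` is an M-ideal in `E`: it is closed and `E* = J* ⊕₁ J^⊥`, that is, the annihilator of `J`
is the range of an L-projection `P` of `E*` (a projection with `‖ψ‖ = ‖P ψ‖ + ‖ψ - P ψ‖`);
the complementary summand is then identified with `J*` by restriction to `J`. -/
def IsMIdeal {E : Type*} [SeminormedAddCommGroup E] [NormedSpace 𝕜 E] (J : Submodule 𝕜 E) : Prop :=
  IsClosed (J : Set E) ∧
    ∃ P : StrongDual 𝕜 E →L[𝕜] StrongDual 𝕜 E,
      (∀ ψ, P (P ψ) = P ψ) ∧ (∀ ψ, ‖ψ‖ = ‖P ψ‖ + ‖ψ - P ψ‖) ∧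
      Set.range P = {ψ : StrongDual 𝕜 E | ∀ x ∈ J, ψ x = 0}

variable (𝕜 X)

/-- The set `{λ x* ⊗ x : (x*, x) ∈ Π(X), |λ| = 1}` in the dual of `L_v(X)`. -/
def elementaryL : Set (StrongDual 𝕜 (Lv 𝕜 X)) :=
  {ψ | ∃ c : 𝕜, ‖c‖ = 1 ∧ ∃ p ∈ dualityPairs 𝕜 X, ψ.toLinearMap = c • tensorL p.1 p.2}

/-- The set `{λ x** ⊗ x* : (x**, x*) ∈ Π(X*), |λ| = 1}` in the dual of `K_v(X)`. -/
def elementaryK : Set (StrongDual 𝕜 (Kv 𝕜 X)) :=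
  {ψ | ∃ c : 𝕜, ‖c‖ = 1 ∧ ∃ p ∈ dualityPairs 𝕜 (StrongDual 𝕜 X),
    ψ.toLinearMap = c • tensorK p.1 p.2}

end NumRad

end

/-!
The functionals `c x* ⊗ x` with `(x*, x) ∈ Π(X)` define the norm `v` of `L_v(X)`, so the dual ball
is their weak-star closed convex hull and the first inclusion is Milman's converse of the
Krein–Milman theorem (`mem_closure_of_mem_extremePoints`,
`toWeakDual_mem_closure_elementaryL`).

For the second inclusion let `P` be the L-projection of `L_v(X)*` onto the annihilator of the
compact operators. An extreme functional `ψ` on `K_v(X)` extends to an extreme functional `φ` on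
`L_v(X)` with `P φ = 0` (`exists_extreme_extension`), hence `φ` is a weak-star limit of functionals
`c x* ⊗ x`. Let `c`, `f`, `y` be weak-star limits of the `c`, of the `x*`, and of the `x` in `X**`.
As compact operators turn the bounded `x` into norm convergent nets, `ψ` is `S ↦ c y(S* f)`.
What remains is `y f = 1`. Put `ω (T) = y (T* f)`. Then `φ = c (ω - P ω)`, and evaluation at the
identity gives `c = c (y f - (P ω)(Id))`, so it is enough that the bilinear form
`(y, f) ↦ (P ω)(Id)`, or the operator `R` on `X**` representing it, vanishes
(`residualOp_eq_zero`).

To see this, consider more generally `ω (T) = F (T** y)` for `F ∈ X***`. The estimate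
`‖1 + T‖ ≤ (1 + ‖T‖²) / (1 - v(T))` for small `T` shows that `‖ω‖` is close to `1`
if `F y` is close to `‖F‖ = ‖y‖ = 1`, and `‖ω - P ω‖` is at least the norm of the restriction
`π F` of `F` to `X`. So
`‖P ω‖` is at most about `1 - ‖π F‖`, which has two consequences. For `F = f ∈ X*` it follows that
`R` has zero numerical range in an approximate sense (`IsSkew`); hence `‖1 + s R‖ ≤ 1 + s² ‖R‖²`
for small real `s`. For general `F` it follows that adding `s (1 - R*) π F` to `F`
increases the norm by at least `s ‖π F‖` (`IsDrifting`). Iterating small steps of this kind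
backwards shows that `X***` is the `ℓ₁`-sum of `X*` and the annihilator of `X`
(`IsDriftSystem.norm_eq`). A skew operator leaves the summands of an `ℓ₁`-sum invariant, so `R`
maps `X` into `X`, where its numerical radius is zero. As `n(X) > 0`, it vanishes on `X`, and
then everywhere because `R*` maps `X*` into itself.
-/

namespace NumRad

set_option maxSynthPendingDepth 3

open Filter Topology RCLike

/-! ### Weak-star closed convex hulls and Milman's theorem -/


section WeakStar

variable {𝕜 : Type*} [RCLike 𝕜] {E : Type*} [SeminormedAddCommGroup E] [NormedSpace 𝕜 E]

instance isScalarTower_weakDual : IsScalarTower ℝ 𝕜 (WeakDual 𝕜 E) :=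
  ⟨fun a b f => DFunLike.ext _ _ fun x => smul_assoc a b (f x)⟩

instance locallyConvexSpace_weakDual : LocallyConvexSpace ℝ (WeakDual 𝕜 E) :=
  (WeakDual.withSeminorms 𝕜 E).toLocallyConvexSpace

/-- A set of functionals that is norming for `E` generates the whole dual ball as its
weak-star closed convex hull. -/
theorem mem_closure_convexHull_of_norming {A : Set (WeakDual 𝕜 E)}
    (hA : ∀ T : E, ∀ r < ‖T‖, ∃ a ∈ A, r < re (a T)) {ψ : WeakDual 𝕜 E}
    (hψ : ∀ T, ‖ψ T‖ ≤ ‖T‖) : ψ ∈ closure (convexHull ℝ A) := by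
  by_contra h
  obtain ⟨l, u, hl, hu⟩ := RCLike.geometric_hahn_banach_closed_point (𝕜 := 𝕜)
    (convex_convexHull ℝ A).closure isClosed_closure h
  obtain ⟨T, hT⟩ := LinearMap.dualEmbedding_surjective (topDualPairing 𝕜 E) l
  have hlT : ∀ φ : WeakDual 𝕜 E, l φ = φ T := fun φ => by rw [← hT]; rfl
  rw [hlT] at hu
  have h1 : u < ‖T‖ := hu.trans_le ((re_le_norm _).trans (hψ T))
  obtain ⟨a, ha, hua⟩ := hA T u h1
  have := hl a (subset_closure (subset_convexHull ℝ A ha))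
  rw [hlT] at this
  exact lt_asymm this hua

end WeakStar

section Milman

variable {V : Type*} [AddCommGroup V] [Module ℝ V] [TopologicalSpace V]
  [IsTopologicalAddGroup V] [ContinuousSMul ℝ V]

theorem isCompact_convexJoin {s t : Set V} (hs : IsCompact s) (ht : IsCompact t) :
    IsCompact (convexJoin ℝ s t) := by
  have h : convexJoin ℝ s t =
      (fun q : ℝ × V × V => (1 - q.1) • q.2.1 + q.1 • q.2.2) '' (Icc (0 : ℝ) 1 ×ˢ s ×ˢ t) := by
    ext x
    simp only [mem_convexJoin, segment_eq_image, mem_image, mem_prod, Prod.exists]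
    constructor
    · rintro ⟨a, ha, b, hb, θ, hθ, rfl⟩
      exact ⟨θ, a, b, ⟨hθ, ha, hb⟩, rfl⟩
    · rintro ⟨θ, a, b, ⟨hθ, ha, hb⟩, rfl⟩
      exact ⟨a, ha, b, hb, θ, hθ, rfl⟩
  rw [h]
  exact (isCompact_Icc.prod (hs.prod ht)).image (by fun_prop)

/-- Milman's converse of the Krein–Milman theorem: if a compact convex set `K` has an extreme
point in the closed convex hull of a subset `A`, this point lies in the closure of `A`.
An extreme point of `K` in the closed convex hull of a finite union of sets lies in the closed
convex hull of one of them, so the claim follows by compactness from the case of small sets. -/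
theorem mem_closure_of_mem_extremePoints [T2Space V] [LocallyConvexSpace ℝ V] {K A : Set V}
    (hK : IsCompact K) (hKc : Convex ℝ K) (hAK : A ⊆ K) {ψ : V} (hψ : ψ ∈ K.extremePoints ℝ)
    (hψA : ψ ∈ closure (convexHull ℝ A)) : ψ ∈ closure A := by
  by_contra hn
  have hsub : ∀ S : Set V, closure (convexHull ℝ (S ∩ closure A)) ⊆ K := fun S =>
    closure_minimal (convexHull_min
      (inter_subset_right.trans (closure_minimal hAK hK.isClosed)) hKc) hK.isClosed
  have hcpt : ∀ S : Set V, IsCompact (closure (convexHull ℝ (S ∩ closure A))) := fun S =>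
    hK.of_isClosed_subset isClosed_closure (hsub S)
  have key : ψ ∉ closure (convexHull ℝ (closure A ∩ closure A)) := by
    refine (hK.of_isClosed_subset isClosed_closure (closure_minimal hAK hK.isClosed)).induction_on
      (p := fun S => ψ ∉ closure (convexHull ℝ (S ∩ closure A))) (by simp) ?_ ?_ ?_
    · intro s t hst ht hs
      exact ht (closure_mono (convexHull_mono (inter_subset_inter_left _ hst)) hs)
    · intro s t hs ht hst
      rcases (s ∩ closure A).eq_empty_or_nonempty with h | hsn
      · rw [union_inter_distrib_right, h, empty_union] at hst
        exact ht hst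
      rcases (t ∩ closure A).eq_empty_or_nonempty with h | htn
      · rw [union_inter_distrib_right, h, union_empty] at hst
        exact hs hst
      have hs' : (closure (convexHull ℝ (s ∩ closure A))).Nonempty :=
        hsn.mono ((subset_convexHull ℝ _).trans subset_closure)
      have ht' : (closure (convexHull ℝ (t ∩ closure A))).Nonempty :=
        htn.mono ((subset_convexHull ℝ _).trans subset_closure)
      have hjoin : ψ ∈ convexJoin ℝ (closure (convexHull ℝ (s ∩ closure A)))
          (closure (convexHull ℝ (t ∩ closure A))) := by
        refine closure_minimal (convexHull_min ?_ ?_)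
          (isCompact_convexJoin (hcpt s) (hcpt t)).isClosed hst
        · rw [union_inter_distrib_right]
          refine union_subset (Subset.trans ?_ (subset_convexJoin_left ht'))
            (Subset.trans ?_ (subset_convexJoin_right hs'))
          · exact (subset_convexHull ℝ _).trans subset_closure
          · exact (subset_convexHull ℝ _).trans subset_closure
        · exact (convex_convexHull ℝ _).closure.convexJoin (convex_convexHull ℝ _).closure
      obtain ⟨a, ha, b, hb, hab⟩ := mem_convexJoin.1 hjoin
      rcases (mem_extremePoints_iff_forall_segment.1 hψ).2 a (hsub s ha) b (hsub t hb) hab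
        with h | h
      · exact hs (h ▸ ha)
      · exact ht (h ▸ hb)
    · intro a ha
      have hne : a ≠ ψ := fun h => hn (h ▸ ha)
      obtain ⟨l, hl⟩ := geometric_hahn_banach_point_point hne
      obtain ⟨r, hr1, hr2⟩ := exists_between hl
      refine ⟨{x | l x < r}, mem_nhdsWithin_of_mem_nhds
        ((isOpen_lt l.continuous continuous_const).mem_nhds hr1), fun h => ?_⟩
      have : closure (convexHull ℝ ({x | l x < r} ∩ closure A)) ⊆ {x | l x ≤ r} := by
        refine closure_minimal (convexHull_min ?_ ?_) (isClosed_le l.continuous continuous_const)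
        · exact fun x hx => (show l x < r from hx.1).le
        · exact convex_halfSpace_le l.isLinear r
      exact not_le.2 hr2 (this h)
  refine key (closure_mono (convexHull_mono ?_) hψA)
  rw [inter_self]
  exact subset_closure

end Milman

section Bound

variable {𝕜 : Type*} [RCLike 𝕜] {Y : Type*} [NormedAddCommGroup Y] [NormedSpace 𝕜 Y]

/-- A lower bound for `1 - B` gives an upper bound for `1 + B = (1 - B²)(1 - B)⁻¹`. -/
theorem norm_add_apply_le_of_lower_bound [CompleteSpace Y] (B : Y →L[𝕜] Y) (hB : ‖B‖ < 1) {m : ℝ}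
    (hm : ∀ w, m * ‖w‖ ≤ ‖w - B w‖) (hm0 : 0 ≤ m) (z : Y) :
    m * ‖z + B z‖ ≤ (1 + ‖B‖ ^ 2) * ‖z‖ := by
  obtain ⟨w, rfl⟩ : ∃ w, z = w - B w := by
    refine ⟨(↑(Units.oneSub B hB)⁻¹ : Y →L[𝕜] Y) z, ?_⟩
    have h := congrArg (fun C : Y →L[𝕜] Y => C z) (Units.mul_inv (Units.oneSub B hB))
    simpa using h.symm
  have h1 : w - B w + B (w - B w) = w - B (B w) := by rw [map_sub]; abel
  have h2 : ‖B (B w)‖ ≤ ‖B‖ ^ 2 * ‖w‖ := by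
    calc _ ≤ ‖B‖ * (‖B‖ * ‖w‖) := (B.le_opNorm _).trans (by gcongr; exact B.le_opNorm _)
      _ = _ := by ring
  rw [h1]
  calc m * ‖w - B (B w)‖ ≤ m * ((1 + ‖B‖ ^ 2) * ‖w‖) := by
        gcongr
        linarith [norm_sub_le w (B (B w))]
    _ = (1 + ‖B‖ ^ 2) * (m * ‖w‖) := by ring
    _ ≤ _ := by gcongr; exact hm w

/-- A norm-one vector almost norming a functional, with a real value. -/
theorem exists_almost_norming (F : StrongDual 𝕜 Y) {ε : ℝ} (hε : 0 < ε) (hF : F ≠ 0) :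
    ∃ y, ‖y‖ = 1 ∧ ‖F‖ - ε ≤ re (F y) := by
  obtain ⟨x, hx, hxF⟩ : ∃ x : Y, ‖x‖ = 1 ∧ ‖F‖ - ε ≤ ‖F x‖ := by
    by_contra! h
    obtain ⟨x₀, hx₀⟩ : ∃ x₀, F x₀ ≠ 0 := by
      by_contra! h0
      exact hF (ContinuousLinearMap.ext h0)
    have hunit : ∀ x : Y, ‖F x‖ ≤ (‖F‖ - ε) * ‖x‖ := fun x => by
      rcases eq_or_ne x 0 with rfl | hx
      · simp
      have hx' : 0 < ‖x‖ := norm_pos_iff.2 hx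
      have := h (((‖x‖⁻¹ : ℝ) : 𝕜) • x) (by
        rw [norm_smul, norm_ofReal, abs_of_pos (inv_pos.2 hx'), inv_mul_cancel₀ hx'.ne'])
      rw [map_smul, norm_smul, norm_ofReal, abs_of_pos (inv_pos.2 hx'), inv_mul_lt_iff₀ hx'] at this
      linarith
    have hpos : 0 ≤ ‖F‖ - ε := by
      have h1 := hunit x₀
      have h2 : 0 < ‖F x₀‖ := norm_pos_iff.2 hx₀
      by_contra! hlt
      nlinarith [norm_nonneg x₀]
    linarith [F.opNorm_le_bound hpos hunit]
  obtain ⟨c, hc, hcF⟩ : ∃ c : 𝕜, ‖c‖ = 1 ∧ ‖F x‖ = c * F x := RCLike.exists_norm_eq_mul_self _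
  refine ⟨c • x, by rw [norm_smul, hc, hx, one_mul], ?_⟩
  rw [map_smul, smul_eq_mul, ← hcF, ofReal_re]
  exact hxF

end Bound

/-! ### L-summands from skew drifts -/


/-- A quantity of first order that is bounded by one of second order is not positive. -/
theorem nonpos_of_forall_mul_le_sq {a b c : ℝ}
    (h : ∀ s > 0, s * c < 1 → s * a ≤ s ^ 2 * b) : a ≤ 0 := by
  have hlim : Tendsto (fun s : ℝ => s * b) (𝓝[>] 0) (𝓝 (0 * b)) :=
    (tendsto_id.mul_const b).mono_left nhdsWithin_le_nhds
  have hc : Tendsto (fun s : ℝ => s * c) (𝓝[>] 0) (𝓝 (0 * c)) :=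
    (tendsto_id.mul_const c).mono_left nhdsWithin_le_nhds
  rw [zero_mul] at hlim hc
  refine ge_of_tendsto hlim ?_
  filter_upwards [hc.eventually (gt_mem_nhds one_pos), self_mem_nhdsWithin] with s h1 h2
  have h2 : 0 < s := h2
  have h3 := h s h2 h1
  rw [sq, mul_assoc] at h3
  exact le_of_mul_le_mul_left h3 h2

theorem exists_dual_ne_zero_of_notMem_range {𝕜 : Type*} [RCLike 𝕜] {Y Z : Type*}
    [NormedAddCommGroup Y] [NormedSpace 𝕜 Y] [NormedAddCommGroup Z] [NormedSpace 𝕜 Z]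
    (J : Y →L[𝕜] Z) (hJ : IsClosed (range J)) {z : Z} (hz : ¬ ∃ y, J y = z) :
    ∃ μ : StrongDual 𝕜 Z, μ z ≠ 0 ∧ ∀ y, μ (J y) = 0 := by
  let _ : NormedSpace ℝ Z := NormedSpace.restrictScalars ℝ 𝕜 Z
  have : IsScalarTower ℝ 𝕜 Z := RestrictScalars.isScalarTower ℝ 𝕜 Z
  have hconv : Convex ℝ (range J) := by
    rintro _ ⟨a, rfl⟩ _ ⟨b, rfl⟩ s t - - -
    exact ⟨(s : 𝕜) • a + (t : 𝕜) • b, by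
      rw [map_add, map_smul, map_smul, RCLike.real_smul_eq_coe_smul (K := 𝕜) s (J a),
        RCLike.real_smul_eq_coe_smul (K := 𝕜) t (J b)]⟩
  obtain ⟨μ, u, h1, h2⟩ := RCLike.geometric_hahn_banach_closed_point (𝕜 := 𝕜) hconv hJ hz
  have h0 : 0 < u := by simpa using h1 0 ⟨0, map_zero _⟩
  have hvan : ∀ y, μ (J y) = 0 := by
    -- a real multiple of a nonzero value would exceed the bound `u`
    intro y
    by_contra hy
    have hy' : 0 < ‖μ (J y)‖ := norm_pos_iff.2 hy
    obtain ⟨c, -, hc⟩ := RCLike.exists_norm_eq_mul_self (μ (J y))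
    have := h1 (J (((u / ‖μ (J y)‖ : ℝ) : 𝕜) • c • y)) ⟨_, rfl⟩
    simp only [map_smul μ, map_smul J, smul_eq_mul] at this
    rw [← hc, re_ofReal_mul, ofReal_re, div_mul_cancel₀ _ hy'.ne'] at this
    exact lt_irrefl _ this
  refine ⟨μ, fun h => ?_, hvan⟩
  rw [h, map_zero] at h2
  exact lt_asymm h0 h2

section LSummand

variable {𝕜 : Type*} [RCLike 𝕜] {A Z : Type*} [NormedAddCommGroup A] [NormedSpace 𝕜 A]
  [NormedAddCommGroup Z] [NormedSpace 𝕜 Z]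

/-- A norm-one projection `ι π` onto a copy of `A` in `Z`, with an operator `S` on `Z` that is
skew (it changes norms only to second order) and for which moving along `ι π - S ι π` increases
the norm of `F` at the rate `‖π F‖`. -/
structure IsDriftSystem (ι : A →L[𝕜] Z) (π : Z →L[𝕜] A) (S : Z →L[𝕜] Z) (ρ : ℝ) : Prop where
  nonneg : 0 ≤ ρ
  norm_ι : ∀ f, ‖ι f‖ = ‖f‖
  norm_π_le : ∀ F, ‖π F‖ ≤ ‖F‖
  π_ι : ∀ f, π (ι f) = f
  skew : ∀ s : ℝ, |s| * ρ < 1 → ∀ F, ‖F + (s : 𝕜) • S F‖ ≤ (1 + s ^ 2 * ρ ^ 2) * ‖F‖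
  drift : ∀ s : ℝ, 0 ≤ s → ∀ F, ‖F‖ + s * ‖π F‖ ≤ ‖F + (s : 𝕜) • (ι (π F) - S (ι (π F)))‖

namespace IsDriftSystem

variable {ι : A →L[𝕜] Z} {π : Z →L[𝕜] A} {S : Z →L[𝕜] Z} {ρ : ℝ}

/-- One half of the decomposition `‖F‖ = ‖π F‖ + ‖F - ι π F‖`, up to an error that vanishes with
the step `s`. The norm of `F` is followed along the backward orbit of `U = 1 + s • (ι π - S ι π)`:
`U` fixes the kernel of `π`, and undoing it `k` times lowers the norm by the sum of the numbers
`s ‖π U⁻ʲ F‖`, which decrease at most geometrically with ratio `(1 + s)(1 + s²ρ²)`. -/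
theorem norm_sub_add_le_aux [CompleteSpace Z] (h : IsDriftSystem ι π S ρ) {s : ℝ} (hs : 0 < s)
    (hsR : s * ρ < 1) (hsW : s * ‖ι ∘L π - S ∘L ι ∘L π‖ < 1) (F : Z) :
    ‖F - ι (π F)‖ - ‖π F‖ + 2 * ((1 + s * ρ ^ 2 + s ^ 2 * ρ ^ 2)⁻¹ * ‖π F‖) ≤ ‖F‖ := by
  have hρ0 : 0 ≤ ρ := h.nonneg
  set W : Z →L[𝕜] Z := ι ∘L π - S ∘L ι ∘L π
  have hW : ∀ F, W F = ι (π F) - S (ι (π F)) := fun F => rfl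
  set r : ℝ := (1 + s) * (1 + s ^ 2 * ρ ^ 2) with hr
  have hr1 : 1 < r := by rw [hr]; nlinarith [show 0 ≤ s ^ 2 * ρ ^ 2 by positivity]
  have hr0 : 0 < r := one_pos.trans hr1
  have hκ : (1 + s * ρ ^ 2 + s ^ 2 * ρ ^ 2)⁻¹ = s / (r - 1) := by
    have h1 : r - 1 = s * (1 + s * ρ ^ 2 + s ^ 2 * ρ ^ 2) := by rw [hr]; ring
    rw [h1, ← div_div, div_self hs.ne', one_div]
  rw [hκ]
  obtain ⟨V, hUV, hVU⟩ : ∃ V : Z →L[𝕜] Z,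
      (∀ G, V G + (s : 𝕜) • W (V G) = G) ∧ (∀ G, V (G + (s : 𝕜) • W G) = G) := by
    have hB : ‖-((s : 𝕜) • W)‖ < 1 := by
      rwa [norm_neg, norm_smul, norm_ofReal, abs_of_pos hs]
    refine ⟨(↑(Units.oneSub _ hB)⁻¹ : Z →L[𝕜] Z), fun G => ?_, fun G => ?_⟩
    · simpa using congrArg (fun C : Z →L[𝕜] Z => C G) (Units.mul_inv (Units.oneSub _ hB))
    · simpa using congrArg (fun C : Z →L[𝕜] Z => C G) (Units.inv_mul (Units.oneSub _ hB))
  -- the kernel of `π` is fixed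
  have hker : ∀ μ, π μ = 0 → V μ = μ := fun μ hμ => by
    have h1 := hVU μ
    rwa [hW, hμ, map_zero, map_zero, sub_zero, smul_zero, add_zero] at h1
  have hkern : ∀ (n : ℕ) μ, π μ = 0 → (V ^ n) μ = μ := fun n μ hμ => by
    induction n with
    | zero => simp
    | succ n ih => rw [pow_succ', mul_apply_eq_comp, ih, hker μ hμ]
  -- the images under `π` decrease at most geometrically along the orbit
  have hgeo : ∀ G, ‖π G‖ ≤ r * ‖π (V G)‖ := fun G => by
    set q := π (V G) with hq
    have h1 : π G = π (((1 + s : ℝ) : 𝕜) • (ι q + ((-(s / (1 + s)) : ℝ) : 𝕜) • S (ι q))) := by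
      have h2 : ((1 + s : ℝ) : 𝕜) * ((-(s / (1 + s)) : ℝ) : 𝕜) = -(s : 𝕜) := by
        rw [← ofReal_mul, ← ofReal_neg]
        congr 1
        field_simp
      rw [smul_add, smul_smul, h2]
      conv_lhs => rw [← hUV G]
      rw [hW, ← hq, map_add, map_add, smul_sub, map_sub, map_smul, map_smul, map_smul, map_smul,
        h.π_ι, ofReal_add, ofReal_one, add_smul, one_smul, neg_smul]
      abel
    have hs1 : s / (1 + s) ≤ s := div_le_self hs.le (by linarith)
    have hs0 : 0 ≤ s / (1 + s) := by positivity
    have h3 := h.skew (-(s / (1 + s)))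
      (by
        rw [abs_neg, abs_of_nonneg hs0]
        exact (mul_le_mul_of_nonneg_right hs1 hρ0).trans_lt hsR) (ι q)
    rw [h1]
    refine (h.norm_π_le _).trans ?_
    rw [norm_smul, norm_ofReal, abs_of_pos (by linarith)]
    calc (1 + s) * ‖ι q + ((-(s / (1 + s)) : ℝ) : 𝕜) • S (ι q)‖
        ≤ (1 + s) * ((1 + s ^ 2 * ρ ^ 2) * ‖q‖) := by
          gcongr
          refine h3.trans ?_
          rw [h.norm_ι, neg_sq]
          gcongr
      _ = r * ‖q‖ := by rw [hr]; ring
  have hgeon : ∀ (n : ℕ) G, r⁻¹ ^ n * ‖π G‖ ≤ ‖π ((V ^ n) G)‖ := fun n G => by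
    induction n with
    | zero => simp
    | succ n ih =>
      rw [pow_succ' V, mul_apply_eq_comp, pow_succ', mul_assoc]
      calc r⁻¹ * (r⁻¹ ^ n * ‖π G‖) ≤ r⁻¹ * (r * ‖π (V ((V ^ n) G))‖) :=
            mul_le_mul_of_nonneg_left (ih.trans (hgeo _)) (inv_nonneg.2 hr0.le)
        _ = _ := by rw [inv_mul_cancel_left₀ hr0.ne']
  -- the norm drops along the orbit
  have hdrop : ∀ (n : ℕ) G,
      ‖(V ^ n) G‖ + s / (r - 1) * (1 - r⁻¹ ^ n) * ‖π G‖ ≤ ‖G‖ := fun n G => by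
    induction n with
    | zero => simp
    | succ n ih =>
      have h1 := h.drift s hs.le ((V ^ (n + 1)) G)
      have h2 : (V ^ (n + 1)) G + (s : 𝕜) • W ((V ^ (n + 1)) G) = (V ^ n) G := by
        rw [pow_succ', mul_apply_eq_comp, hUV]
      rw [← hW, h2] at h1
      have h3 := mul_le_mul_of_nonneg_left (hgeon (n + 1) G) hs.le
      have h4 : s / (r - 1) * (1 - r⁻¹ ^ (n + 1)) * ‖π G‖ =
          s / (r - 1) * (1 - r⁻¹ ^ n) * ‖π G‖ + s * (r⁻¹ ^ (n + 1) * ‖π G‖) := by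
        have : r - 1 ≠ 0 := by linarith
        rw [pow_succ]
        field_simp
        ring
      linarith
  -- both `F` and `ι (π F)` lose the same amount
  set μ := F - ι (π F) with hμ
  have hμ0 : π μ = 0 := by rw [hμ, map_sub, h.π_ι, sub_self]
  have hn : ∀ n : ℕ, ‖μ‖ - ‖π F‖ + 2 * (s / (r - 1) * (1 - r⁻¹ ^ n) * ‖π F‖) ≤ ‖F‖ := fun n => by
    have h1 := hdrop n F
    have h2 := hdrop n (ι (π F))
    have h3 : (V ^ n) F = μ + (V ^ n) (ι (π F)) := by
      conv_lhs => rw [show F = μ + ι (π F) by rw [hμ]; abel]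
      rw [map_add, hkern n μ hμ0]
    have h4 : ‖μ‖ ≤ ‖μ + (V ^ n) (ι (π F))‖ + ‖(V ^ n) (ι (π F))‖ := by
      simpa using norm_sub_le (μ + (V ^ n) (ι (π F))) ((V ^ n) (ι (π F)))
    rw [h3] at h1
    rw [h.norm_ι, h.π_ι] at h2
    linarith
  have hlim : Tendsto (fun n : ℕ => ‖μ‖ - ‖π F‖ + 2 * (s / (r - 1) * (1 - r⁻¹ ^ n) * ‖π F‖)) atTop
      (𝓝 (‖μ‖ - ‖π F‖ + 2 * (s / (r - 1) * (1 - 0) * ‖π F‖))) := by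
    have := tendsto_pow_atTop_nhds_zero_of_lt_one (inv_nonneg.2 hr0.le) (inv_lt_one_of_one_lt₀ hr1)
    exact tendsto_const_nhds.add
      ((((tendsto_const_nhds.sub this).const_mul _).mul_const _).const_mul _)
  have := le_of_tendsto' hlim hn
  simpa using this

/-- The projection `ι π` is an L-projection. -/
theorem norm_eq [CompleteSpace Z] (h : IsDriftSystem ι π S ρ) (F : Z) :
    ‖F‖ = ‖π F‖ + ‖F - ι (π F)‖ := by
  refine le_antisymm ?_ ?_
  · have := norm_add_le (ι (π F)) (F - ι (π F))
    rwa [add_sub_cancel, h.norm_ι] at this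
  set a := ‖F - ι (π F)‖
  set b := ‖π F‖
  have hlim : Tendsto (fun s : ℝ => a - b + 2 * ((1 + s * ρ ^ 2 + s ^ 2 * ρ ^ 2)⁻¹ * b)) (𝓝[>] 0)
      (𝓝 (a - b + 2 * ((1 + 0 * ρ ^ 2 + 0 ^ 2 * ρ ^ 2)⁻¹ * b))) := by
    refine ContinuousAt.tendsto
      (f := fun s : ℝ => a - b + 2 * ((1 + s * ρ ^ 2 + s ^ 2 * ρ ^ 2)⁻¹ * b)) ?_ |>.mono_left
      nhdsWithin_le_nhds
    fun_prop (disch := simp)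
  have hsmall : ∀ a : ℝ, ∀ᶠ s : ℝ in 𝓝[>] 0, s * a < 1 := fun a => by
    have : Tendsto (fun s : ℝ => s * a) (𝓝 0) (𝓝 (0 * a)) := tendsto_id.mul_const a
    rw [zero_mul] at this
    exact nhdsWithin_le_nhds (this.eventually (gt_mem_nhds one_pos))
  have := le_of_tendsto hlim (by
    filter_upwards [hsmall ρ, hsmall ‖ι ∘L π - S ∘L ι ∘L π‖, self_mem_nhdsWithin] with s h1 h2 h3
    exact h.norm_sub_add_le_aux h3 h1 h2 F)
  simp at this
  linarith

theorem norm_add_pair_le (h : IsDriftSystem ι π S ρ) {s : ℝ} (hs : 0 < s) (hsR : s * ρ < 1)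
    (F : Z) :
    ‖F + (s : 𝕜) • S F‖ + ‖F - (s : 𝕜) • S F‖ ≤ 2 * ‖F‖ + s ^ 2 * (2 * ρ ^ 2 * ‖F‖) := by
  have h1 := h.skew s (by rwa [abs_of_pos hs]) F
  have h2 := h.skew (-s) (by rwa [abs_neg, abs_of_pos hs]) F
  rw [ofReal_neg, neg_smul, ← sub_eq_add_neg, neg_sq] at h2
  linarith

/-- The range of `ι` is invariant: a skew operator changes the norm only to second order, while
an `ℓ₁`-orthogonal component of `S (ι f)` would change it to first order. -/
theorem apply_ι [CompleteSpace Z] (h : IsDriftSystem ι π S ρ) (f : A) :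
    S (ι f) = ι (π (S (ι f))) := by
  set G := S (ι f)
  rw [← sub_eq_zero, ← norm_le_zero_iff]
  refine nonpos_of_forall_mul_le_sq (b := ρ ^ 2 * ‖f‖) (c := ρ) fun s hs hsR => ?_
  have h1 := h.norm_add_pair_le hs hsR (ι f)
  rw [h.norm_eq, h.norm_eq (ι f - _)] at h1
  have e1 : ι f + (s : 𝕜) • G - ι (π (ι f + (s : 𝕜) • G)) = (s : 𝕜) • (G - ι (π G)) := by
    rw [map_add, map_smul, h.π_ι, map_add, map_smul, smul_sub]; abel
  have e2 : ι f - (s : 𝕜) • G - ι (π (ι f - (s : 𝕜) • G)) = -((s : 𝕜) • (G - ι (π G))) := by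
    rw [map_sub, map_smul, h.π_ι, map_sub, map_smul, smul_sub]; abel
  rw [e1, e2, norm_neg, norm_smul, norm_ofReal, abs_of_pos hs, h.norm_ι] at h1
  have h3 := norm_add_le (π (ι f + (s : 𝕜) • G)) (π (ι f - (s : 𝕜) • G))
  rw [← map_add, add_add_sub_cancel, map_add, h.π_ι] at h3
  have h4 : ‖f + f‖ = 2 * ‖f‖ := by
    rw [← two_smul 𝕜 f, norm_smul, RCLike.norm_two]
  linarith

/-- The kernel of `π` is invariant, for the same reason. -/
theorem π_apply [CompleteSpace Z] (h : IsDriftSystem ι π S ρ) {μ : Z} (hμ : π μ = 0) :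
    π (S μ) = 0 := by
  set G := S μ
  rw [← norm_le_zero_iff]
  refine nonpos_of_forall_mul_le_sq (b := ρ ^ 2 * ‖μ‖) (c := ρ) fun s hs hsR => ?_
  have h1 := h.norm_add_pair_le hs hsR μ
  rw [h.norm_eq, h.norm_eq (μ - _)] at h1
  have e1 : π (μ + (s : 𝕜) • G) = (s : 𝕜) • π G := by
    rw [map_add, map_smul, hμ, zero_add]
  have e2 : π (μ - (s : 𝕜) • G) = -((s : 𝕜) • π G) := by
    rw [map_sub, map_smul, hμ, zero_sub]
  rw [e1, e2, norm_neg, norm_smul, norm_ofReal, abs_of_pos hs] at h1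
  have h3 := norm_add_le (μ + (s : 𝕜) • G - ι ((s : 𝕜) • π G))
    (μ - (s : 𝕜) • G - ι (-((s : 𝕜) • π G)))
  have e3 : μ + (s : 𝕜) • G - ι ((s : 𝕜) • π G) + (μ - (s : 𝕜) • G - ι (-((s : 𝕜) • π G))) =
      (2 : 𝕜) • μ := by
    rw [map_neg, two_smul]; abel
  rw [e3, norm_smul, RCLike.norm_two] at h3
  linarith

end IsDriftSystem

end LSummand

noncomputable section Embedded

variable {𝕜 : Type*} [RCLike 𝕜] {X : Type*} [NormedAddCommGroup X] [NormedSpace 𝕜 X]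

/-- The canonical isometry `X → X**`. -/
abbrev incl (𝕜 : Type*) [RCLike 𝕜] (X : Type*) [NormedAddCommGroup X] [NormedSpace 𝕜 X] :
    X →L[𝕜] StrongDual 𝕜 (StrongDual 𝕜 X) :=
  NormedSpace.inclusionInDoubleDual 𝕜 X

/-- The restriction map `X*** → X*`, a left inverse of the canonical embedding of `X*`. -/
def restr (𝕜 : Type*) [RCLike 𝕜] (X : Type*) [NormedAddCommGroup X] [NormedSpace 𝕜 X] :
    StrongDual 𝕜 (StrongDual 𝕜 (StrongDual 𝕜 X)) →L[𝕜] StrongDual 𝕜 X :=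
  (ContinuousLinearMap.compL 𝕜 X (StrongDual 𝕜 (StrongDual 𝕜 X)) 𝕜).flip (incl 𝕜 X)

@[simp] theorem restr_apply (F : StrongDual 𝕜 (StrongDual 𝕜 (StrongDual 𝕜 X))) (x : X) :
    restr 𝕜 X F x = F (incl 𝕜 X x) := rfl

@[simp] theorem restr_incl (f : StrongDual 𝕜 X) : restr 𝕜 X (incl 𝕜 (StrongDual 𝕜 X) f) = f := rfl

theorem norm_incl (x : X) : ‖incl 𝕜 X x‖ = ‖x‖ :=
  (NormedSpace.inclusionInDoubleDualLi 𝕜).norm_map x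

theorem norm_restr_le (F : StrongDual 𝕜 (StrongDual 𝕜 (StrongDual 𝕜 X))) :
    ‖restr 𝕜 X F‖ ≤ ‖F‖ :=
  ContinuousLinearMap.opNorm_le_bound _ (norm_nonneg _) fun x => by
    rw [restr_apply, ← norm_incl (𝕜 := 𝕜) x]
    exact F.le_opNorm _

/-- The adjoint of `R`, as the bounded operator `F ↦ F ∘ R`. -/
def dualOp {Y : Type*} [NormedAddCommGroup Y] [NormedSpace 𝕜 Y] (R : Y →L[𝕜] Y) :
    StrongDual 𝕜 Y →L[𝕜] StrongDual 𝕜 Y :=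
  (ContinuousLinearMap.compL 𝕜 Y Y 𝕜).flip R

@[simp] theorem dualOp_apply {Y : Type*} [NormedAddCommGroup Y] [NormedSpace 𝕜 Y] (R : Y →L[𝕜] Y)
    (F : StrongDual 𝕜 Y) (y : Y) : dualOp R F y = F (R y) := rfl

theorem norm_dualOp_le {Y : Type*} [NormedAddCommGroup Y] [NormedSpace 𝕜 Y] (R : Y →L[𝕜] Y) :
    ‖dualOp R‖ ≤ ‖R‖ :=
  ContinuousLinearMap.opNorm_le_bound _ (norm_nonneg _) fun F => by
    rw [mul_comm]; exact F.opNorm_comp_le R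

/-- The numerical range of `R` vanishes approximately: `(R y)(f)` is small whenever `y f` is close
to `‖y‖ = ‖f‖ = 1`, uniformly in the pair. -/
def IsSkew {Y : Type*} [NormedAddCommGroup Y] [NormedSpace 𝕜 Y]
    (R : StrongDual 𝕜 Y →L[𝕜] StrongDual 𝕜 Y) : Prop :=
  ∀ ε > 0, ∃ δ > 0, ∀ (f : Y) (y : StrongDual 𝕜 Y), ‖f‖ = 1 → ‖y‖ = 1 →
    1 - δ ≤ re (y f) → ‖R y f‖ ≤ ε

/-- A skew operator does not decrease norms to first order, in either direction. -/
theorem IsSkew.norm_le {Y : Type*} [NormedAddCommGroup Y] [NormedSpace 𝕜 Y]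
    {R : StrongDual 𝕜 Y →L[𝕜] StrongDual 𝕜 Y} (hR : IsSkew R) (s : ℝ) (y : StrongDual 𝕜 Y) :
    ‖y‖ ≤ ‖y + (s : 𝕜) • R y‖ := by
  rcases eq_or_ne y 0 with rfl | hy
  · simp
  have key : ∀ y : StrongDual 𝕜 Y, ‖y‖ = 1 → 1 ≤ ‖y + (s : 𝕜) • R y‖ := by
    intro y hy
    have hy0 : y ≠ 0 := by rintro rfl; simp at hy
    refine le_of_forall_pos_le_add fun ε hε => ?_
    obtain ⟨δ, hδ, h⟩ := hR (ε / (2 * (|s| + 1))) (by positivity)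
    obtain ⟨f, hf, hyf⟩ := exists_almost_norming y (lt_min hδ (half_pos hε)) hy0
    rw [hy] at hyf
    have h1 := h f y hf hy (by linarith [min_le_left δ (ε / 2)])
    have h2 : ‖(s : 𝕜) • R y f‖ ≤ ε / 2 := by
      rw [norm_smul, norm_ofReal]
      calc |s| * ‖R y f‖ ≤ (|s| + 1) * (ε / (2 * (|s| + 1))) := by
            gcongr; linarith
        _ = ε / 2 := by field_simp
    have h3 : re (y f) - ‖(s : 𝕜) • R y f‖ ≤ ‖y + (s : 𝕜) • R y‖ := by
      have h4 := (y + (s : 𝕜) • R y).le_opNorm f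
      rw [hf, mul_one] at h4
      have h5 := (re_le_norm _).trans h4
      simp only [add_apply, smul_apply, map_add] at h5
      have h6 := (abs_le.1 (abs_re_le_norm ((s : 𝕜) • R y f))).1
      linarith
    linarith [min_le_right δ (ε / 2)]
  have hy' : 0 < ‖y‖ := norm_pos_iff.2 hy
  have h1 := key (((‖y‖⁻¹ : ℝ) : 𝕜) • y) (by
    rw [norm_smul, norm_ofReal, abs_of_pos (inv_pos.2 hy'), inv_mul_cancel₀ hy'.ne'])
  rw [map_smul, smul_comm, ← smul_add, norm_smul, norm_ofReal, abs_of_pos (inv_pos.2 hy'),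
    le_inv_mul_iff₀ hy', mul_one] at h1
  exact h1

theorem IsSkew.norm_add_le {Y : Type*} [NormedAddCommGroup Y] [NormedSpace 𝕜 Y]
    {R : StrongDual 𝕜 Y →L[𝕜] StrongDual 𝕜 Y} (hR : IsSkew R) {s : ℝ} (hs : |s| * ‖R‖ < 1)
    (y : StrongDual 𝕜 Y) : ‖y + (s : 𝕜) • R y‖ ≤ (1 + s ^ 2 * ‖R‖ ^ 2) * ‖y‖ := by
  have hB : ‖(s : 𝕜) • R‖ = |s| * ‖R‖ := by rw [norm_smul, norm_ofReal]
  have h := norm_add_apply_le_of_lower_bound ((s : 𝕜) • R) (by rwa [hB]) (m := 1)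
    (fun w => by
      have := hR.norm_le (-s) w
      rw [one_mul, smul_apply, sub_eq_add_neg, ← neg_smul]
      simpa using this) zero_le_one y
  rw [hB, mul_pow, sq_abs, one_mul] at h
  exact h

theorem IsSkew.norm_add_dualOp_le {Y : Type*} [NormedAddCommGroup Y] [NormedSpace 𝕜 Y]
    {R : StrongDual 𝕜 Y →L[𝕜] StrongDual 𝕜 Y} (hR : IsSkew R) {s : ℝ} (hs : |s| * ‖R‖ < 1)
    (F : StrongDual 𝕜 (StrongDual 𝕜 Y)) :
    ‖F + (s : 𝕜) • dualOp R F‖ ≤ (1 + s ^ 2 * ‖R‖ ^ 2) * ‖F‖ := by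
  refine ContinuousLinearMap.opNorm_le_bound _ (by positivity) fun y => ?_
  have h : (F + (s : 𝕜) • dualOp R F) y = F (y + (s : 𝕜) • R y) := by simp
  rw [h]
  calc ‖F (y + (s : 𝕜) • R y)‖ ≤ ‖F‖ * ((1 + s ^ 2 * ‖R‖ ^ 2) * ‖y‖) :=
        (F.le_opNorm _).trans (by gcongr; exact hR.norm_add_le hs y)
    _ = _ := by ring

/-- The operator `F ↦ ι π F - R* ι π F` on `X***`, where `π` is the restriction `X*** → X*` and
`ι` the embedding `X* → X***`. -/
def driftOp (R : StrongDual 𝕜 (StrongDual 𝕜 X) →L[𝕜] StrongDual 𝕜 (StrongDual 𝕜 X)) :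
    StrongDual 𝕜 (StrongDual 𝕜 (StrongDual 𝕜 X)) →L[𝕜]
      StrongDual 𝕜 (StrongDual 𝕜 (StrongDual 𝕜 X)) :=
  (1 - dualOp R) ∘L (incl 𝕜 (StrongDual 𝕜 X)) ∘L (restr 𝕜 X)

/-- At almost norming pairs `(F, y)` in `X*** × X**`, the value of `driftOp R F` at `y` has real
part almost at least `‖π F‖`, where `π F` is the restriction of `F` to `X`. -/
def IsDrifting (R : StrongDual 𝕜 (StrongDual 𝕜 X) →L[𝕜] StrongDual 𝕜 (StrongDual 𝕜 X)) : Prop :=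
  ∀ ε > 0, ∃ δ > 0, ∀ (F : StrongDual 𝕜 (StrongDual 𝕜 (StrongDual 𝕜 X)))
    (y : StrongDual 𝕜 (StrongDual 𝕜 X)), ‖F‖ = 1 → ‖y‖ = 1 → 1 - δ ≤ re (F y) →
    ‖restr 𝕜 X F‖ - ε ≤ re (y (restr 𝕜 X F) - R y (restr 𝕜 X F))

theorem IsDrifting.norm_le
    {R : StrongDual 𝕜 (StrongDual 𝕜 X) →L[𝕜] StrongDual 𝕜 (StrongDual 𝕜 X)} (hR : IsDrifting R)
    {s : ℝ} (hs : 0 ≤ s) (F) : ‖F‖ + s * ‖restr 𝕜 X F‖ ≤ ‖F + (s : 𝕜) • driftOp R F‖ := by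
  rcases eq_or_ne F 0 with rfl | hF
  · simp
  have key : ∀ F : StrongDual 𝕜 (StrongDual 𝕜 (StrongDual 𝕜 X)), ‖F‖ = 1 →
      1 + s * ‖restr 𝕜 X F‖ ≤ ‖F + (s : 𝕜) • driftOp R F‖ := by
    intro F hF
    have hF0 : F ≠ 0 := by rintro rfl; simp at hF
    refine le_of_forall_pos_le_add fun ε hε => ?_
    obtain ⟨δ, hδ, h⟩ := hR (ε / (2 * (s + 1))) (by positivity)
    obtain ⟨y, hy, hFy⟩ := exists_almost_norming F (lt_min hδ (half_pos hε)) hF0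
    rw [hF] at hFy
    have h1 := h F y hF hy (by linarith [min_le_left δ (ε / 2)])
    have h2 : s * (ε / (2 * (s + 1))) ≤ ε / 2 := by
      calc s * (ε / (2 * (s + 1))) ≤ (s + 1) * (ε / (2 * (s + 1))) := by gcongr; linarith
        _ = ε / 2 := by field_simp
    have h4 := (F + (s : 𝕜) • driftOp R F).le_opNorm y
    rw [hy, mul_one] at h4
    have h5 := (re_le_norm _).trans h4
    have h6 : (F + (s : 𝕜) • driftOp R F) y
        = F y + (s : 𝕜) * (y (restr 𝕜 X F) - R y (restr 𝕜 X F)) := rfl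
    rw [h6, map_add, re_ofReal_mul] at h5
    have h7 := mul_le_mul_of_nonneg_left h1 hs
    linarith [min_le_right δ (ε / 2)]
  have hF' : 0 < ‖F‖ := norm_pos_iff.2 hF
  have h1 := key (((‖F‖⁻¹ : ℝ) : 𝕜) • F) (by
    rw [norm_smul, norm_ofReal, abs_of_pos (inv_pos.2 hF'), inv_mul_cancel₀ hF'.ne'])
  rw [map_smul, map_smul, smul_comm, ← smul_add, norm_smul, norm_smul, norm_ofReal,
    abs_of_pos (inv_pos.2 hF'), le_inv_mul_iff₀ hF'] at h1
  calc _ = ‖F‖ * (1 + s * (‖F‖⁻¹ * ‖restr 𝕜 X F‖)) := by field_simp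
    _ ≤ _ := h1


section Blocks

variable {R : StrongDual 𝕜 (StrongDual 𝕜 X) →L[𝕜] StrongDual 𝕜 (StrongDual 𝕜 X)}

theorem IsDrifting.isDriftSystem (hR : IsDrifting R) (hR' : IsSkew R) :
    IsDriftSystem (incl 𝕜 (StrongDual 𝕜 X)) (restr 𝕜 X) (dualOp R) ‖R‖ where
  nonneg := norm_nonneg _
  norm_ι := norm_incl
  norm_π_le := norm_restr_le
  π_ι := restr_incl
  skew _ hs F := hR'.norm_add_dualOp_le hs F
  drift _ hs F := hR.norm_le hs F

/-- `R` restricts to an operator on `X`, because `R*` leaves the annihilator of `X` invariant. -/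
theorem IsDrifting.exists_restrict [CompleteSpace X] (hR : IsDrifting R) (hR' : IsSkew R) :
    ∃ R₀ : X →L[𝕜] X, ∀ x, R (incl 𝕜 X x) = incl 𝕜 X (R₀ x) := by
  have hiso : Isometry (incl 𝕜 X) := (NormedSpace.inclusionInDoubleDualLi 𝕜 (E := X)).isometry
  have hmem : ∀ x, ∃ z, incl 𝕜 X z = R (incl 𝕜 X x) := by
    intro x
    have hclosed : IsClosed (range (incl 𝕜 X)) := hiso.isClosedEmbedding.isClosed_range
    by_contra h
    obtain ⟨μ, hμ1, hμ2⟩ : ∃ μ : StrongDual 𝕜 (StrongDual 𝕜 (StrongDual 𝕜 X)),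
        μ (R (incl 𝕜 X x)) ≠ 0 ∧ ∀ z, μ (incl 𝕜 X z) = 0 :=
      exists_dual_ne_zero_of_notMem_range (incl 𝕜 X) hclosed h
    have hμ : restr 𝕜 X μ = 0 := ContinuousLinearMap.ext hμ2
    exact hμ1 (congrArg (fun g => g x) ((hR.isDriftSystem hR').π_apply hμ))
  choose R₀ hR₀ using hmem
  refine ⟨LinearMap.mkContinuous ⟨⟨R₀, fun x y => hiso.injective ?_⟩,
    fun c x => hiso.injective ?_⟩ ‖R‖ fun x => ?_, fun x => (hR₀ x).symm⟩
  · rw [map_add, hR₀, hR₀, hR₀, map_add, map_add]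
  · change incl 𝕜 X (R₀ (c • x)) = incl 𝕜 X (c • R₀ x)
    rw [map_smul, hR₀, hR₀, map_smul, map_smul]
  · change ‖R₀ x‖ ≤ _
    rw [← norm_incl (𝕜 := 𝕜), hR₀, ← norm_incl (𝕜 := 𝕜) x]
    exact R.le_opNorm _

theorem IsDrifting.eq_zero (hR : IsDrifting R) (hR' : IsSkew R)
    (h : ∀ x, R (incl 𝕜 X x) = 0) : R = 0 := by
  refine ContinuousLinearMap.ext fun y => ContinuousLinearMap.ext fun f => ?_
  have h1 : restr 𝕜 X (dualOp R (incl 𝕜 _ f)) = 0 := by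
    ext x
    rw [restr_apply, dualOp_apply, h, map_zero, zero_apply]
  have h2 := (hR.isDriftSystem hR').apply_ι f
  rw [h1, map_zero] at h2
  exact congrArg (fun G => G y) h2

end Blocks

end Embedded

/-! ### Numerical radius estimates and functionals on `L_v(X)` -/


section Radius

variable {𝕜 : Type*} [RCLike 𝕜] {X : Type*} [NormedAddCommGroup X] [NormedSpace 𝕜 X]

theorem numericalRadius_le_norm (T : X →L[𝕜] X) : numericalRadius T ≤ ‖T‖ := by
  refine Real.sSup_le ?_ (norm_nonneg T)
  rintro _ ⟨q, hq, rfl⟩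
  exact norm_apply_le_opNorm T hq

theorem numericalRadius_smul (c : 𝕜) (T : X →L[𝕜] X) :
    numericalRadius (c • T) = ‖c‖ * numericalRadius T :=
  map_smul_eq_mul (numericalRadiusSeminorm 𝕜 X) c T

theorem numericalIndex_mul_norm_le (T : X →L[𝕜] X) :
    numericalIndex 𝕜 X * ‖T‖ ≤ numericalRadius T := by
  rcases eq_or_ne T 0 with rfl | hT
  · rw [norm_zero, mul_zero]
    exact numericalRadius_nonneg _
  have hT' : 0 < ‖T‖ := norm_pos_iff.2 hT
  have h : numericalIndex 𝕜 X ≤ numericalRadius (((‖T‖⁻¹ : ℝ) : 𝕜) • T) := by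
    refine csInf_le ⟨0, ?_⟩ (mem_image_of_mem _ ?_)
    · rintro _ ⟨S, -, rfl⟩
      exact numericalRadius_nonneg S
    · change ‖((‖T‖⁻¹ : ℝ) : 𝕜) • T‖ = 1
      rw [norm_smul, norm_ofReal, abs_of_pos (inv_pos.2 hT'), inv_mul_cancel₀ hT'.ne']
  rw [numericalRadius_smul, norm_ofReal, abs_of_pos (inv_pos.2 hT'), le_inv_mul_iff₀ hT'] at h
  linarith

theorem norm_toOp_le (hn : 0 < numericalIndex 𝕜 X) (T : Lv 𝕜 X) :
    ‖toOp 𝕜 X T‖ ≤ (numericalIndex 𝕜 X)⁻¹ * ‖T‖ := by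
  rw [le_inv_mul_iff₀ hn]
  exact numericalIndex_mul_norm_le _

theorem sub_numericalRadius_mul_norm_le (B : X →L[𝕜] X) (w : X) :
    (1 - numericalRadius B) * ‖w‖ ≤ ‖w - B w‖ := by
  rcases eq_or_ne w 0 with rfl | hw
  · simp
  have hw' : 0 < ‖w‖ := norm_pos_iff.2 hw
  obtain ⟨g, hg, hgw⟩ := exists_dual_vector 𝕜 w hw'.ne'
  have hmem : (g, ((‖w‖⁻¹ : ℝ) : 𝕜) • w) ∈ dualityPairs 𝕜 X := by
    refine ⟨hg, ?_, ?_⟩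
    · rw [norm_smul, norm_ofReal, abs_of_pos (inv_pos.2 hw'), inv_mul_cancel₀ hw'.ne']
    · rw [map_smul, hgw, smul_eq_mul, ← ofReal_mul, inv_mul_cancel₀ hw'.ne', ofReal_one]
  have h := norm_apply_le_numericalRadius B hmem
  simp only [map_smul, norm_smul, norm_ofReal, abs_of_pos (inv_pos.2 hw')] at h
  rw [inv_mul_le_iff₀ hw'] at h
  have h1 : ‖g (w - B w)‖ ≤ ‖w - B w‖ := by simpa [hg] using g.le_opNorm (w - B w)
  have h2 : ‖w‖ ≤ ‖g (w - B w)‖ + ‖g (B w)‖ := by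
    have := norm_add_le (g (w - B w)) (g (B w))
    rwa [← map_add, sub_add_cancel, hgw, norm_ofReal, abs_of_pos hw'] at this
  linarith

/-- The Lumer–Phillips type estimate: to first order the norm of `1 + B` is governed by the
numerical radius of `B`. -/
theorem norm_add_apply_le [CompleteSpace X] (B : X →L[𝕜] X) (hB : ‖B‖ < 1)
    (hv : numericalRadius B ≤ 1) (z : X) :
    (1 - numericalRadius B) * ‖z + B z‖ ≤ (1 + ‖B‖ ^ 2) * ‖z‖ :=
  norm_add_apply_le_of_lower_bound B hB (sub_numericalRadius_mul_norm_le B) (by linarith) z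

end Radius

noncomputable section Functionals

variable {𝕜 : Type*} [RCLike 𝕜] {X : Type*} [NormedAddCommGroup X] [NormedSpace 𝕜 X]

/-- The functional `T ↦ F(T** y)` on `L_v(X)`, for `F ∈ X***` and `y ∈ X**`. Its continuity
needs `n(X) > 0`. -/
def bitensor (hn : 0 < numericalIndex 𝕜 X) (F : StrongDual 𝕜 (StrongDual 𝕜 (StrongDual 𝕜 X)))
    (y : StrongDual 𝕜 (StrongDual 𝕜 X)) : StrongDual 𝕜 (Lv 𝕜 X) :=
  LinearMap.mkContinuous
    { toFun := fun T => F (y.comp (dualOp (toOp 𝕜 X T)))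
      map_add' := fun S T => by
        rw [← map_add]
        congr 1
        ext f
        simp [dualOp]
      map_smul' := fun c T => by
        rw [RingHom.id_apply, ← map_smul]
        congr 1
        ext f
        simp [dualOp] }
    ((numericalIndex 𝕜 X)⁻¹ * ‖F‖ * ‖y‖) fun T => by
      calc ‖F (y.comp (dualOp (toOp 𝕜 X T)))‖ ≤ ‖F‖ * (‖y‖ * ‖toOp 𝕜 X T‖) :=
            (F.le_opNorm _).trans (by
              gcongr
              exact (y.opNorm_comp_le _).trans (by gcongr; exact norm_dualOp_le _))
        _ ≤ ‖F‖ * (‖y‖ * ((numericalIndex 𝕜 X)⁻¹ * ‖T‖)) := by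
            gcongr
            exact norm_toOp_le hn T
        _ = _ := by ring

variable {hn : 0 < numericalIndex 𝕜 X}

theorem bitensor_apply (F : StrongDual 𝕜 (StrongDual 𝕜 (StrongDual 𝕜 X)))
    (y : StrongDual 𝕜 (StrongDual 𝕜 X)) (T : Lv 𝕜 X) :
    bitensor hn F y T = F (y.comp (dualOp (toOp 𝕜 X T))) := rfl

theorem bitensor_incl_apply (f : StrongDual 𝕜 X) (y : StrongDual 𝕜 (StrongDual 𝕜 X))
    (T : Lv 𝕜 X) : bitensor hn (incl 𝕜 _ f) y T = y (f.comp (toOp 𝕜 X T)) := rfl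

theorem norm_bitensor_le (F : StrongDual 𝕜 (StrongDual 𝕜 (StrongDual 𝕜 X)))
    (y : StrongDual 𝕜 (StrongDual 𝕜 X)) :
    ‖bitensor hn F y‖ ≤ (numericalIndex 𝕜 X)⁻¹ * ‖F‖ * ‖y‖ :=
  LinearMap.mkContinuous_norm_le _ (by positivity) _

/-- The identity of `X` as an element of `L_v(X)`. -/
def idLv (𝕜 : Type*) [RCLike 𝕜] (X : Type*) [NormedAddCommGroup X] [NormedSpace 𝕜 X] : Lv 𝕜 X :=
  (toOp 𝕜 X).symm (ContinuousLinearMap.id 𝕜 X)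

theorem norm_idLv_le : ‖idLv 𝕜 X‖ ≤ 1 := by
  rw [norm_Lv, idLv, LinearEquiv.apply_symm_apply]
  exact (numericalRadius_le_norm _).trans ContinuousLinearMap.norm_id_le

theorem bitensor_idLv (F : StrongDual 𝕜 (StrongDual 𝕜 (StrongDual 𝕜 X)))
    (y : StrongDual 𝕜 (StrongDual 𝕜 X)) : bitensor hn F y (idLv 𝕜 X) = F y := rfl

/-- At almost norming pairs the functional `T ↦ F(T** y)` has norm almost at most one. -/
theorem exists_norm_bitensor_le [CompleteSpace X] (hn : 0 < numericalIndex 𝕜 X) {ε : ℝ}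
    (hε : 0 < ε) :
    ∃ δ > 0, ∀ (F : StrongDual 𝕜 (StrongDual 𝕜 (StrongDual 𝕜 X)))
      (y : StrongDual 𝕜 (StrongDual 𝕜 X)), ‖F‖ = 1 → ‖y‖ = 1 → 1 - δ ≤ re (F y) →
      ‖bitensor hn F y‖ ≤ 1 + ε := by
  set c := (numericalIndex 𝕜 X)⁻¹ with hc
  have hc0 : 0 < c := inv_pos.2 hn
  obtain ⟨s, hs0, hs1, hsc, hsε⟩ : ∃ s : ℝ, 0 < s ∧ s < 1 ∧ s * c < 1 ∧
      (1 + s * c ^ 2) / (1 - s) ≤ 1 + ε / 2 := by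
    have h1 : Tendsto (fun s : ℝ => (1 + s * c ^ 2) / (1 - s)) (𝓝[>] 0)
        (𝓝 ((1 + 0 * c ^ 2) / (1 - 0))) := by
      refine ContinuousAt.tendsto (f := fun s : ℝ => (1 + s * c ^ 2) / (1 - s)) ?_ |>.mono_left
        nhdsWithin_le_nhds
      fun_prop (disch := simp)
    have h2 : Tendsto (fun s : ℝ => s * c) (𝓝[>] 0) (𝓝 (0 * c)) :=
      (tendsto_id.mul_const c).mono_left nhdsWithin_le_nhds
    have h3 : Tendsto (fun s : ℝ => s) (𝓝[>] 0) (𝓝 0) := tendsto_id.mono_left nhdsWithin_le_nhds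
    simp only [zero_mul, add_zero, sub_zero, div_one] at h1 h2
    obtain ⟨s, h1, h2, h3, h4⟩ := ((h1.eventually_lt_const (show 1 < 1 + ε / 2 by linarith)).and
      ((h2.eventually_lt_const one_pos).and
      ((h3.eventually_lt_const one_pos).and self_mem_nhdsWithin))).exists
    exact ⟨s, h4, h3, h2, h1.le⟩
  refine ⟨s * (ε / 2), by positivity, fun F y hF hy hFy => ?_⟩
  -- the bound on operators of numerical radius at most one
  have key : ∀ T : Lv 𝕜 X, ‖T‖ ≤ 1 → ‖bitensor hn F y T‖ ≤ 1 + ε := by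
    intro T hT
    obtain ⟨u, hu, huT⟩ := RCLike.exists_norm_eq_mul_self (bitensor hn F y T)
    set B : X →L[𝕜] X := ((s : 𝕜) * u) • toOp 𝕜 X T with hB
    have hsu : ‖(s : 𝕜) * u‖ = s := by rw [norm_mul, hu, norm_ofReal, abs_of_pos hs0, mul_one]
    have hBn : ‖B‖ ≤ s * c := by
      rw [hB, norm_smul, hsu]
      gcongr
      refine (norm_toOp_le hn T).trans ?_
      rw [← hc]
      nlinarith
    have hBv : numericalRadius B ≤ s := by
      rw [hB, numericalRadius_smul, hsu]
      have : numericalRadius (toOp 𝕜 X T) ≤ 1 := hT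
      nlinarith
    have hM : ‖ContinuousLinearMap.id 𝕜 X + B‖ ≤ (1 + (s * c) ^ 2) / (1 - s) := by
      refine ContinuousLinearMap.opNorm_le_bound _ (by
        have : 0 < 1 - s := by linarith
        positivity) fun z => ?_
      have h1 := norm_add_apply_le B (hBn.trans_lt hsc) (hBv.trans hs1.le) z
      rw [div_mul_eq_mul_div, le_div_iff₀ (by linarith), mul_comm]
      calc (1 - s) * ‖(ContinuousLinearMap.id 𝕜 X + B) z‖
          ≤ (1 - numericalRadius B) * ‖z + B z‖ := by
            change (1 - s) * ‖z + B z‖ ≤ _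
            gcongr
        _ ≤ (1 + ‖B‖ ^ 2) * ‖z‖ := h1
        _ ≤ (1 + (s * c) ^ 2) * ‖z‖ := by gcongr
    have h2 : F (y.comp (dualOp (ContinuousLinearMap.id 𝕜 X + B))) =
        F y + ((s * ‖bitensor hn F y T‖ : ℝ) : 𝕜) := by
      have h3 : F (y.comp (dualOp (ContinuousLinearMap.id 𝕜 X + B))) =
          bitensor hn F y (idLv 𝕜 X + ((s : 𝕜) * u) • T) := rfl
      rw [h3, map_add, map_smul, bitensor_idLv, smul_eq_mul, mul_assoc, ← huT, ofReal_mul]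
    have h4 : ‖F (y.comp (dualOp (ContinuousLinearMap.id 𝕜 X + B)))‖ ≤
        (1 + (s * c) ^ 2) / (1 - s) := by
      refine (F.le_opNorm _).trans ?_
      rw [hF, one_mul]
      refine (y.opNorm_comp_le _).trans ?_
      rw [hy, one_mul]
      exact (norm_dualOp_le _).trans hM
    have h5 := (re_le_norm _).trans h4
    rw [h2, map_add, ofReal_re] at h5
    have h6 : (1 + (s * c) ^ 2) / (1 - s) = 1 + s * ((1 + s * c ^ 2) / (1 - s)) := by
      have : 1 - s ≠ 0 := by linarith
      field_simp
      ring
    rw [h6] at h5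
    have h7 : s * ‖bitensor hn F y T‖ ≤ s * (1 + ε) := by
      have := mul_le_mul_of_nonneg_left hsε hs0.le
      linarith
    exact le_of_mul_le_mul_left h7 hs0
  refine ContinuousLinearMap.opNorm_le_bound _ (by positivity) fun T => ?_
  rcases eq_or_ne ‖T‖ 0 with hT | hT
  · have h1 := (bitensor hn F y).le_opNorm T
    rw [hT, mul_zero] at h1 ⊢
    exact h1
  · have hT' : 0 < ‖T‖ := lt_of_le_of_ne (norm_nonneg _) hT.symm
    have h1 := key (((‖T‖⁻¹ : ℝ) : 𝕜) • T) (by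
      rw [norm_smul, norm_ofReal, abs_of_pos (inv_pos.2 hT'), inv_mul_cancel₀ hT])
    rw [map_smul, norm_smul, norm_ofReal, abs_of_pos (inv_pos.2 hT'), inv_mul_le_iff₀ hT'] at h1
    linarith

end Functionals

section Compact

variable {𝕜 : Type*} [RCLike 𝕜] {X : Type*} [NormedAddCommGroup X] [NormedSpace 𝕜 X]

theorem exists_ultrafilter_of_mem_closure_image {α β : Type*} [TopologicalSpace β] {g : α → β}
    {B : Set α} {x : β} (hx : x ∈ closure (g '' B)) :
    ∃ V : Ultrafilter α, B ∈ V ∧ Tendsto g V (𝓝 x) := by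
  have := mem_closure_iff_nhdsWithin_neBot.1 hx
  have hne : NeBot (comap g (𝓝[g '' B] x) ⊓ 𝓟 B) :=
    comap_inf_principal_neBot_of_image_mem this self_mem_nhdsWithin
  refine ⟨Ultrafilter.of (comap g (𝓝[g '' B] x) ⊓ 𝓟 B), ?_, ?_⟩
  · exact Ultrafilter.of_le (comap g (𝓝[g '' B] x) ⊓ 𝓟 B) (mem_inf_of_right (mem_principal_self B))
  · have h1 : Tendsto g (comap g (𝓝[g '' B] x)) (𝓝 x) :=
      tendsto_comap.mono_right nhdsWithin_le_nhds
    exact h1.mono_left ((Ultrafilter.of_le _).trans inf_le_left)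

theorem exists_tendsto_of_isCompactOperator {S : X →L[𝕜] X} (hS : IsCompactOperator S)
    {V : Ultrafilter X} {r : ℝ} (hV : Metric.closedBall 0 r ∈ V) : ∃ z, Tendsto S V (𝓝 z) := by
  obtain ⟨K, hK, hsub⟩ := hS.image_closedBall_subset_compact (f := (S : X →ₗ[𝕜] X)) r
  obtain ⟨z, -, hz⟩ := hK.ultrafilter_le_nhds (V.map S) (by
    rw [le_principal_iff]
    exact mem_of_superset (image_mem_map hV) hsub)
  exact ⟨z, hz⟩

/-- Goldstine's theorem, for an ultrafilter. -/
theorem exists_ultrafilter_tendsto_bidual (y : StrongDual 𝕜 (StrongDual 𝕜 X)) (hy : ‖y‖ ≤ 1) :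
    ∃ V : Ultrafilter X, Metric.closedBall 0 1 ∈ V ∧
      ∀ f : StrongDual 𝕜 X, Tendsto (fun x => f x) V (𝓝 (y f)) := by
  set A : Set (WeakDual 𝕜 (StrongDual 𝕜 X)) :=
    (fun x : X => StrongDual.toWeakDual (incl 𝕜 X x)) '' Metric.closedBall 0 1 with hA
  have hconv : Convex ℝ A := by
    rintro _ ⟨a, ha, rfl⟩ _ ⟨b, hb, rfl⟩ s t hs ht hst
    rw [mem_closedBall_zero_iff] at ha hb
    refine ⟨(s : 𝕜) • a + (t : 𝕜) • b, ?_, ?_⟩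
    · rw [mem_closedBall_zero_iff]
      refine (norm_add_le _ _).trans ?_
      rw [norm_smul, norm_smul, norm_ofReal, norm_ofReal, abs_of_nonneg hs, abs_of_nonneg ht]
      nlinarith
    · refine DFunLike.ext _ _ fun f => ?_
      change f ((s : 𝕜) • a + (t : 𝕜) • b) = s • f a + t • f b
      rw [map_add, map_smul, map_smul, RCLike.real_smul_eq_coe_mul, RCLike.real_smul_eq_coe_mul,
        smul_eq_mul, smul_eq_mul]
  have hmem : StrongDual.toWeakDual y ∈ closure (convexHull ℝ A) := by
    refine mem_closure_convexHull_of_norming (fun f r hr => ?_) fun f => ?_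
    · rcases eq_or_ne f 0 with rfl | hf
      · exact ⟨_, ⟨0, by simp, rfl⟩, by simpa using hr⟩
      obtain ⟨x, hx, hfx⟩ := exists_almost_norming f (half_pos (sub_pos.2 hr)) hf
      exact ⟨_, ⟨x, by simp [hx], rfl⟩, by
        change r < re (f x)
        linarith⟩
    · exact (y.le_opNorm f).trans (by nlinarith [norm_nonneg f])
  rw [hconv.convexHull_eq] at hmem
  obtain ⟨V, hV, hVy⟩ := exists_ultrafilter_of_mem_closure_image hmem
  exact ⟨V, hV, fun f => ((WeakDual.eval_continuous f).tendsto _).comp hVy⟩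

/-- The second adjoint of a compact operator maps `X**` into `X`. -/
theorem exists_forall_apply_comp_eq {S : X →L[𝕜] X} (hS : IsCompactOperator S)
    (y : StrongDual 𝕜 (StrongDual 𝕜 X)) : ∃ z, ∀ f : StrongDual 𝕜 X, y (f.comp S) = f z := by
  have key : ∀ y : StrongDual 𝕜 (StrongDual 𝕜 X), ‖y‖ ≤ 1 →
      ∃ z, ∀ f : StrongDual 𝕜 X, y (f.comp S) = f z := by
    intro y hy
    obtain ⟨V, hV, hVy⟩ := exists_ultrafilter_tendsto_bidual y hy
    obtain ⟨z, hz⟩ := exists_tendsto_of_isCompactOperator hS hV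
    exact ⟨z, fun f => tendsto_nhds_unique (hVy (f.comp S)) ((f.continuous.tendsto z).comp hz)⟩
  rcases eq_or_ne y 0 with rfl | hy
  · exact ⟨0, fun f => by simp⟩
  have hy' : 0 < ‖y‖ := norm_pos_iff.2 hy
  obtain ⟨z, hz⟩ := key (((‖y‖⁻¹ : ℝ) : 𝕜) • y) (by
    rw [norm_smul, norm_ofReal, abs_of_pos (inv_pos.2 hy'), inv_mul_cancel₀ hy'.ne'])
  refine ⟨((‖y‖ : ℝ) : 𝕜) • z, fun f => ?_⟩
  rw [map_smul, ← hz f, smul_apply, smul_smul, ← ofReal_mul, mul_inv_cancel₀ hy'.ne', ofReal_one,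
    one_smul]

end Compact

/-! ### The residual operator of an M-ideal of compact operators -/


noncomputable section MIdeal

variable {𝕜 : Type*} [RCLike 𝕜] {X : Type*} [NormedAddCommGroup X] [NormedSpace 𝕜 X]

theorem isCompactOperator_smulRight (g : StrongDual 𝕜 X) (x : X) :
    IsCompactOperator (g.smulRight x) := by
  have h : IsCompactOperator (ContinuousLinearMap.toSpanSingleton 𝕜 x) :=
    isCompactOperator_of_locallyCompactSpace_rng (ContinuousLinearMap.toSpanSingleton 𝕜 x)
  exact h.comp_clm g

/-- `P` is an L-projection of the dual of `L_v(X)` onto the annihilator of the compact operators. -/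
structure IsCompactLProjection (P : StrongDual 𝕜 (Lv 𝕜 X) →L[𝕜] StrongDual 𝕜 (Lv 𝕜 X)) :
    Prop where
  idem : ∀ ψ, P (P ψ) = P ψ
  norm_eq : ∀ ψ, ‖ψ‖ = ‖P ψ‖ + ‖ψ - P ψ‖
  range_eq : range P = {ψ : StrongDual 𝕜 (Lv 𝕜 X) | ∀ x ∈ Kv 𝕜 X, ψ x = 0}

namespace IsCompactLProjection

variable {P : StrongDual 𝕜 (Lv 𝕜 X) →L[𝕜] StrongDual 𝕜 (Lv 𝕜 X)}

theorem apply_eq_zero (hP : IsCompactLProjection P) (ψ : StrongDual 𝕜 (Lv 𝕜 X)) {S : Lv 𝕜 X}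
    (hS : S ∈ Kv 𝕜 X) : P ψ S = 0 := by
  have h : P ψ ∈ range P := ⟨ψ, rfl⟩
  rw [hP.range_eq] at h
  exact h S hS

theorem apply_eq_self (hP : IsCompactLProjection P) {ψ : StrongDual 𝕜 (Lv 𝕜 X)}
    (hψ : ∀ S ∈ Kv 𝕜 X, ψ S = 0) : P ψ = ψ := by
  have h : ψ ∈ range P := by
    rw [hP.range_eq]
    exact hψ
  obtain ⟨φ, rfl⟩ := h
  exact hP.idem φ

theorem sub_apply_eq (hP : IsCompactLProjection P) {φ ψ : StrongDual 𝕜 (Lv 𝕜 X)}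
    (h : ∀ S ∈ Kv 𝕜 X, φ S = ψ S) : φ - P φ = ψ - P ψ := by
  have h1 := hP.apply_eq_self (ψ := φ - ψ) fun S hS => by
    rw [sub_apply, h S hS, sub_self]
  rw [map_sub] at h1
  rw [sub_eq_sub_iff_sub_eq_sub, h1]

variable {hn : 0 < numericalIndex 𝕜 X}

/-- On compact operators, `T ↦ F(T** y)` depends only on the restriction of `F` to `X`. -/
theorem sub_apply_bitensor (hP : IsCompactLProjection P)
    (F : StrongDual 𝕜 (StrongDual 𝕜 (StrongDual 𝕜 X))) (y : StrongDual 𝕜 (StrongDual 𝕜 X)) :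
    bitensor hn F y - P (bitensor hn F y) =
      bitensor hn (incl 𝕜 _ (restr 𝕜 X F)) y - P (bitensor hn (incl 𝕜 _ (restr 𝕜 X F)) y) := by
  refine hP.sub_apply_eq fun S hS => ?_
  obtain ⟨z, hz⟩ := exists_forall_apply_comp_eq (S := toOp 𝕜 X S) hS y
  have h1 : y.comp (dualOp (toOp 𝕜 X S)) = incl 𝕜 X z := ContinuousLinearMap.ext hz
  rw [bitensor_apply, bitensor_incl_apply, hz, h1, restr_apply]

/-- The component complementary to the annihilator of the compact operators has at least the norm
seen by the rank-one operators. -/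
theorem norm_restr_mul_le (hP : IsCompactLProjection P)
    (F : StrongDual 𝕜 (StrongDual 𝕜 (StrongDual 𝕜 X))) (y : StrongDual 𝕜 (StrongDual 𝕜 X)) :
    ‖restr 𝕜 X F‖ * ‖y‖ ≤ ‖bitensor hn F y - P (bitensor hn F y)‖ := by
  set N := ‖bitensor hn F y - P (bitensor hn F y)‖ with hN
  set f := restr 𝕜 X F
  -- rank-one operators are compact test elements
  have h1 : ∀ (g : StrongDual 𝕜 X) (x : X), ‖f x‖ * ‖y g‖ ≤ N * (‖g‖ * ‖x‖) := by
    intro g x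
    set S : Lv 𝕜 X := (toOp 𝕜 X).symm (g.smulRight x) with hS
    have hSc : S ∈ Kv 𝕜 X := by
      change IsCompactOperator (g.smulRight x)
      exact isCompactOperator_smulRight g x
    have h2 : (bitensor hn F y - P (bitensor hn F y)) S = y g * f x := by
      rw [sub_apply, hP.apply_eq_zero _ hSc, sub_zero, bitensor_apply]
      have : y.comp (dualOp (toOp 𝕜 X S)) = y g • incl 𝕜 X x := by
        ext h
        have h3 : dualOp (toOp 𝕜 X S) h = h x • g := by
          ext w
          simp [hS, mul_comm]
        rw [ContinuousLinearMap.comp_apply, h3, map_smul, smul_apply, NormedSpace.dual_def,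
          smul_eq_mul, smul_eq_mul, mul_comm]
      rw [this, map_smul, smul_eq_mul]
      rfl
    have h4 := (bitensor hn F y - P (bitensor hn F y)).le_opNorm S
    rw [h2, norm_mul, mul_comm, norm_Lv] at h4
    refine h4.trans ?_
    gcongr
    refine (numericalRadius_le_norm _).trans ?_
    rw [hS, LinearEquiv.apply_symm_apply, ContinuousLinearMap.norm_smulRight_apply]
  have h2 : ∀ g : StrongDual 𝕜 X, ‖f‖ * ‖y g‖ ≤ N * ‖g‖ := by
    intro g
    rw [mul_comm, ← norm_smul]
    refine ContinuousLinearMap.opNorm_le_bound _ (by positivity) fun x => ?_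
    rw [smul_apply, norm_smul, mul_comm, mul_assoc]
    exact h1 g x
  have h3 : ‖((‖f‖ : ℝ) : 𝕜) • y‖ ≤ N := by
    refine ContinuousLinearMap.opNorm_le_bound _ (norm_nonneg _) fun g => ?_
    rw [smul_apply, norm_smul, norm_ofReal, abs_norm]
    exact h2 g
  rwa [norm_smul, norm_ofReal, abs_norm] at h3

end IsCompactLProjection

/-- The operator `R` on `X**` whose associated bilinear form `(R y)(f)` is the value at the
identity of the component in the annihilator of the compact operators of the functional
`T ↦ y(T* f)`. -/
def residualOp (hn : 0 < numericalIndex 𝕜 X)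
    (P : StrongDual 𝕜 (Lv 𝕜 X) →L[𝕜] StrongDual 𝕜 (Lv 𝕜 X)) :
    StrongDual 𝕜 (StrongDual 𝕜 X) →L[𝕜] StrongDual 𝕜 (StrongDual 𝕜 X) :=
  LinearMap.mkContinuous₂
    (LinearMap.mk₂ 𝕜 (fun y f => P (bitensor hn (incl 𝕜 _ f) y) (idLv 𝕜 X))
      (fun y z f => by
        have : bitensor hn (incl 𝕜 _ f) (y + z) =
          bitensor hn (incl 𝕜 _ f) y + bitensor hn (incl 𝕜 _ f) z := by ext; rfl
        rw [this, map_add, add_apply])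
      (fun c y f => by
        have : bitensor hn (incl 𝕜 _ f) (c • y) = c • bitensor hn (incl 𝕜 _ f) y := by ext; rfl
        rw [this, map_smul, smul_apply])
      (fun y f g => by
        have : bitensor hn (incl 𝕜 _ (f + g)) y =
            bitensor hn (incl 𝕜 _ f) y + bitensor hn (incl 𝕜 _ g) y := by
          ext T
          rw [add_apply, map_add]; rfl
        rw [this, map_add, add_apply])
      (fun c y f => by
        have : bitensor hn (incl 𝕜 _ (c • f)) y = c • bitensor hn (incl 𝕜 _ f) y := by
          ext T
          rw [smul_apply, map_smul]; rfl
        rw [this, map_smul, smul_apply]))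
    (‖P‖ * (numericalIndex 𝕜 X)⁻¹) fun y f => by
      rw [LinearMap.mk₂_apply]
      calc ‖P (bitensor hn (incl 𝕜 _ f) y) (idLv 𝕜 X)‖
          ≤ ‖P (bitensor hn (incl 𝕜 _ f) y)‖ * ‖idLv 𝕜 X‖ := ContinuousLinearMap.le_opNorm _ _
        _ ≤ ‖P‖ * ((numericalIndex 𝕜 X)⁻¹ * ‖f‖ * ‖y‖) * 1 := by
            gcongr
            · refine (P.le_opNorm _).trans ?_
              gcongr
              refine (norm_bitensor_le _ _).trans ?_
              rw [norm_incl]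
            · exact norm_idLv_le
        _ = _ := by ring

theorem residualOp_apply (hn : 0 < numericalIndex 𝕜 X)
    (P : StrongDual 𝕜 (Lv 𝕜 X) →L[𝕜] StrongDual 𝕜 (Lv 𝕜 X))
    (y : StrongDual 𝕜 (StrongDual 𝕜 X)) (f : StrongDual 𝕜 X) :
    residualOp hn P y f = P (bitensor hn (incl 𝕜 _ f) y) (idLv 𝕜 X) := rfl

namespace IsCompactLProjection

variable [CompleteSpace X] {P : StrongDual 𝕜 (Lv 𝕜 X) →L[𝕜] StrongDual 𝕜 (Lv 𝕜 X)}

theorem isSkew_residualOp (hP : IsCompactLProjection P) (hn : 0 < numericalIndex 𝕜 X) :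
    IsSkew (residualOp hn P) := by
  intro ε hε
  obtain ⟨δ, hδ, h⟩ := exists_norm_bitensor_le hn hε
  refine ⟨δ, hδ, fun f y hf hy hfy => ?_⟩
  have h1 := h (incl 𝕜 _ f) y (by rw [norm_incl, hf]) hy hfy
  have h2 := hP.norm_restr_mul_le (hn := hn) (incl 𝕜 _ f) y
  rw [restr_incl, hf, hy, mul_one] at h2
  have h3 := hP.norm_eq (bitensor hn (incl 𝕜 _ f) y)
  rw [residualOp_apply]
  refine ((P (bitensor hn (incl 𝕜 _ f) y)).le_opNorm _).trans ?_
  calc _ ≤ ‖P (bitensor hn (incl 𝕜 _ f) y)‖ * 1 := by gcongr; exact norm_idLv_le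
    _ ≤ ε := by linarith

theorem isDrifting_residualOp (hP : IsCompactLProjection P) (hn : 0 < numericalIndex 𝕜 X) :
    IsDrifting (residualOp hn P) := by
  intro ε hε
  obtain ⟨δ, hδ, h⟩ := exists_norm_bitensor_le hn (half_pos hε)
  refine ⟨min δ (ε / 2), lt_min hδ (half_pos hε), fun F y hF hy hFy => ?_⟩
  have h1 := h F y hF hy (by linarith [min_le_left δ (ε / 2)])
  have h2 := hP.norm_restr_mul_le (hn := hn) F y
  rw [hy, mul_one] at h2
  have h3 := hP.norm_eq (bitensor hn F y)
  have h4 : y (restr 𝕜 X F) - residualOp hn P y (restr 𝕜 X F) =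
      F y - P (bitensor hn F y) (idLv 𝕜 X) :=
    (congrArg (fun ψ => ψ (idLv 𝕜 X)) (hP.sub_apply_bitensor (hn := hn) F y)).symm
  have h5 : ‖P (bitensor hn F y) (idLv 𝕜 X)‖ ≤ ‖P (bitensor hn F y)‖ := by
    refine ((P (bitensor hn F y)).le_opNorm _).trans ?_
    exact mul_le_of_le_one_right (norm_nonneg _) norm_idLv_le
  have h6 := (re_le_norm (P (bitensor hn F y) (idLv 𝕜 X))).trans h5
  rw [h4, map_sub]
  linarith [min_le_right δ (ε / 2)]

/-- The residual operator vanishes: it restricts to an operator on `X` of numerical radius zero,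
and `n(X) > 0`. -/
theorem residualOp_eq_zero (hP : IsCompactLProjection P) (hn : 0 < numericalIndex 𝕜 X) :
    residualOp hn P = 0 := by
  have hs := hP.isSkew_residualOp hn
  have hd := hP.isDrifting_residualOp hn
  obtain ⟨R₀, hR₀⟩ := hd.exists_restrict hs
  refine hd.eq_zero hs fun x => ?_
  have hv : numericalRadius R₀ ≤ 0 := by
    refine Real.sSup_le ?_ le_rfl
    rintro _ ⟨⟨f, x⟩, ⟨hf, hx, hfx⟩, rfl⟩
    refine le_of_forall_pos_le_add fun ε hε => ?_
    obtain ⟨δ, hδ, h⟩ := hs ε hε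
    have h1 := h f (incl 𝕜 X x) hf (by rw [norm_incl, hx]) (by
      rw [NormedSpace.dual_def, show f x = 1 from hfx, one_re]
      linarith)
    rw [hR₀] at h1
    simpa using h1
  have h0 : ‖R₀‖ ≤ 0 := by
    have := numericalIndex_mul_norm_le R₀
    by_contra! hpos
    nlinarith
  rw [hR₀, norm_le_zero_iff.1 h0, zero_apply, map_zero]

end IsCompactLProjection

end MIdeal

/-! ### Extreme functionals -/


section ExtremeL

variable {𝕜 : Type*} [RCLike 𝕜] {X : Type*} [NormedAddCommGroup X] [NormedSpace 𝕜 X]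

theorem dualityPairs_nonempty [Nontrivial X] : (dualityPairs 𝕜 X).Nonempty := by
  obtain ⟨x, hx⟩ := exists_ne (0 : X)
  have hx' : 0 < ‖x‖ := norm_pos_iff.2 hx
  obtain ⟨g, hg, hgx⟩ := exists_dual_vector 𝕜 x hx'.ne'
  refine ⟨(g, ((‖x‖⁻¹ : ℝ) : 𝕜) • x), hg, ?_, ?_⟩
  · rw [norm_smul, norm_ofReal, abs_of_pos (inv_pos.2 hx'), inv_mul_cancel₀ hx'.ne']
  · rw [map_smul, hgx, smul_eq_mul, ← ofReal_mul, inv_mul_cancel₀ hx'.ne', ofReal_one]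

theorem norm_le_one_of_mem_elementaryL {ψ : StrongDual 𝕜 (Lv 𝕜 X)} (hψ : ψ ∈ elementaryL 𝕜 X) :
    ‖ψ‖ ≤ 1 := by
  obtain ⟨c, hc, p, hp, h⟩ := hψ
  refine ContinuousLinearMap.opNorm_le_bound _ zero_le_one fun T => ?_
  have h1 : ψ T = c * p.1 (toOp 𝕜 X T p.2) := LinearMap.congr_fun h T
  rw [h1, norm_mul, hc]
  gcongr
  exact norm_apply_le_numericalRadius _ hp

theorem exists_mem_elementaryL_lt [Nontrivial X] (T : Lv 𝕜 X) {r : ℝ} (hr : r < ‖T‖) :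
    ∃ ψ ∈ elementaryL 𝕜 X, r < re (ψ T) := by
  obtain ⟨_, ⟨p, hp, rfl⟩, hrp⟩ :=
    exists_lt_of_lt_csSup (dualityPairs_nonempty (𝕜 := 𝕜) (X := X) |>.image _) hr
  obtain ⟨c, hc, hcp⟩ := RCLike.exists_norm_eq_mul_self (p.1 (toOp 𝕜 X T p.2))
  refine ⟨(c • tensorL p.1 p.2).mkContinuous 1 fun S => ?_, ⟨c, hc, p, hp, rfl⟩, ?_⟩
  · change ‖c * p.1 (toOp 𝕜 X S p.2)‖ ≤ _
    rw [norm_mul, hc]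
    gcongr
    exact norm_apply_le_numericalRadius _ hp
  · change r < re (c * p.1 (toOp 𝕜 X T p.2))
    rw [← hcp, ofReal_re]
    exact hrp

/-- Since the pairs of `Π(X)` define the norm of `L_v(X)`, the extreme functionals lie in the
weak-star closure of the elementary ones. -/
theorem toWeakDual_mem_closure_elementaryL [Nontrivial X] {ψ : StrongDual 𝕜 (Lv 𝕜 X)}
    (hψ : ψ ∈ Set.extremePoints ℝ (Metric.closedBall (0 : StrongDual 𝕜 (Lv 𝕜 X)) 1)) :
    StrongDual.toWeakDual ψ ∈ closure ((fun φ : StrongDual 𝕜 (Lv 𝕜 X) =>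
      StrongDual.toWeakDual φ) '' elementaryL 𝕜 X) := by
  refine mem_closure_of_mem_extremePoints
    (WeakDual.isCompact_closedBall (0 : StrongDual 𝕜 (Lv 𝕜 X)) 1) ?_ ?_ hψ ?_
  · exact convex_closedBall (0 : StrongDual 𝕜 (Lv 𝕜 X)) 1
  · rintro _ ⟨φ, hφ, rfl⟩
    exact mem_closedBall_zero_iff.2 (norm_le_one_of_mem_elementaryL hφ)
  · refine mem_closure_convexHull_of_norming (fun T r hr => ?_) fun T => ?_
    · obtain ⟨φ, hφ, h⟩ := exists_mem_elementaryL_lt T hr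
      exact ⟨_, ⟨φ, hφ, rfl⟩, h⟩
    · have h1 : ‖ψ‖ ≤ 1 := mem_closedBall_zero_iff.1 hψ.1
      exact (ψ.le_opNorm T).trans (mul_le_of_le_one_left (norm_nonneg _) h1)

end ExtremeL

section ExtremeK

variable {𝕜 : Type*} [RCLike 𝕜] {X : Type*} [NormedAddCommGroup X] [NormedSpace 𝕜 X]

theorem norm_eq_one_of_mem_extremePoints {V : Type*} [SeminormedAddCommGroup V]
    [NormedSpace ℝ V] (hV : ∃ φ : V, ‖φ‖ ≠ 0) {ψ : V}
    (hψ : ψ ∈ Set.extremePoints ℝ (Metric.closedBall (0 : V) 1)) :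
    ‖ψ‖ = 1 := by
  have hle : ‖ψ‖ ≤ 1 := mem_closedBall_zero_iff.1 hψ.1
  by_contra hne
  have hlt : ‖ψ‖ < 1 := lt_of_le_of_ne hle hne
  obtain ⟨φ, hφ⟩ := hV
  have hφ' : 0 < ‖φ‖ := lt_of_le_of_ne (norm_nonneg φ) hφ.symm
  -- `ψ` is the midpoint of `ψ + w` and `ψ - w` for a small `w`
  set w : V := ((1 - ‖ψ‖) / ‖φ‖) • φ with hw
  have hwn : ‖w‖ = 1 - ‖ψ‖ := by
    rw [hw, norm_smul, Real.norm_eq_abs, abs_of_pos (div_pos (sub_pos.2 hlt) hφ'),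
      div_mul_cancel₀ _ hφ'.ne']
  have h := hψ.2 (x₁ := ψ + w) (by
      rw [mem_closedBall_zero_iff]; linarith [norm_add_le ψ w]) (x₂ := ψ - w) (by
      rw [mem_closedBall_zero_iff]; linarith [norm_sub_le ψ w])
    ⟨1 / 2, 1 / 2, by norm_num, by norm_num, by norm_num, by
      rw [← smul_add, add_add_sub_cancel, ← two_smul ℝ ψ, smul_smul]; norm_num⟩
  rw [add_eq_left] at h
  rw [h, norm_zero] at hwn
  linarith

theorem exists_dual_Kv_norm_ne_zero [Nontrivial X] (hn : 0 < numericalIndex 𝕜 X) :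
    ∃ φ : StrongDual 𝕜 (Kv 𝕜 X), ‖φ‖ ≠ 0 := by
  obtain ⟨⟨g, x⟩, hg, hx, hgx⟩ := dualityPairs_nonempty (𝕜 := 𝕜) (X := X)
  simp only at hg hx hgx
  have hSc : (toOp 𝕜 X).symm (g.smulRight x) ∈ Kv 𝕜 X := by
    change IsCompactOperator (g.smulRight x)
    exact isCompactOperator_smulRight g x
  have hpos : ‖(⟨_, hSc⟩ : Kv 𝕜 X)‖ ≠ 0 := by
    have h1 := numericalIndex_mul_norm_le (g.smulRight x)
    rw [ContinuousLinearMap.norm_smulRight_apply, hg, hx] at h1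
    have h2 : ‖(⟨_, hSc⟩ : Kv 𝕜 X)‖ = numericalRadius (g.smulRight x) := rfl
    rw [h2]
    intro h3
    linarith
  obtain ⟨φ, hφ, -⟩ := exists_dual_vector 𝕜 (⟨_, hSc⟩ : Kv 𝕜 X) hpos
  exact ⟨φ, by rw [hφ]; exact one_ne_zero⟩

/-- An extreme functional on `K_v(X)` extends to an extreme functional on `L_v(X)` in the range
of the complementary L-projection. -/
theorem IsCompactLProjection.exists_extreme_extension [Nontrivial X]
    {P : StrongDual 𝕜 (Lv 𝕜 X) →L[𝕜] StrongDual 𝕜 (Lv 𝕜 X)} (hP : IsCompactLProjection P)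
    (hn : 0 < numericalIndex 𝕜 X) {ψ : StrongDual 𝕜 (Kv 𝕜 X)}
    (hψ : ψ ∈ Set.extremePoints ℝ (Metric.closedBall (0 : StrongDual 𝕜 (Kv 𝕜 X)) 1)) :
    ∃ φ : StrongDual 𝕜 (Lv 𝕜 X), (∀ S : Kv 𝕜 X, φ S = ψ S) ∧ P φ = 0 ∧
      φ ∈ Set.extremePoints ℝ (Metric.closedBall (0 : StrongDual 𝕜 (Lv 𝕜 X)) 1) := by
  have hne := exists_dual_Kv_norm_ne_zero (𝕜 := 𝕜) (X := X) hn
  have hψ1 : ‖ψ‖ = 1 := norm_eq_one_of_mem_extremePoints hne hψ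
  obtain ⟨φ₀, hφ₀, hφ₀n⟩ := exists_extension_norm_eq (Kv 𝕜 X) ψ
  have hPφ : P (φ₀ - P φ₀) = 0 := by rw [map_sub, hP.idem, sub_self]
  have hext : ∀ S : Kv 𝕜 X, (φ₀ - P φ₀) S = ψ S := fun S => by
    rw [sub_apply, hP.apply_eq_zero _ S.2, sub_zero, hφ₀]
  set φ := φ₀ - P φ₀
  have hφn : ‖φ‖ ≤ 1 := by
    have := hP.norm_eq φ₀
    linarith [norm_nonneg (P φ₀)]
  have hφn' : 1 ≤ ‖φ‖ := by
    rw [← hψ1]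
    refine ContinuousLinearMap.opNorm_le_bound _ (norm_nonneg _) fun S => ?_
    rw [← hext]
    exact φ.le_opNorm _
  refine ⟨φ, hext, hPφ, mem_closedBall_zero_iff.2 hφn, fun α hα β hβ hαβ => ?_⟩
  rw [mem_closedBall_zero_iff] at hα hβ
  set res : StrongDual 𝕜 (Lv 𝕜 X) → StrongDual 𝕜 (Kv 𝕜 X) := fun χ => χ.comp (Kv 𝕜 X).subtypeL
  have hres : ∀ χ : StrongDual 𝕜 (Lv 𝕜 X), ‖χ‖ ≤ 1 →
      res χ ∈ Metric.closedBall (0 : StrongDual 𝕜 (Kv 𝕜 X)) 1 := fun χ hχ => by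
    rw [mem_closedBall_zero_iff]
    refine ContinuousLinearMap.opNorm_le_bound _ zero_le_one fun S => ?_
    exact (χ.le_opNorm _).trans (mul_le_mul_of_nonneg_right hχ (norm_nonneg _))
  have hαψ : res α = ψ := by
    refine hψ.2 (hres α hα) (hres β hβ) ?_
    obtain ⟨a, b, ha, hb, hab, h⟩ := hαβ
    refine ⟨a, b, ha, hb, hab, ?_⟩
    ext S
    rw [← hext, ← h]
    rfl
  have h1 : α - P α = φ - P φ := hP.sub_apply_eq fun S hS => by
    have h2 := congrArg (fun χ => χ ⟨S, hS⟩) hαψ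
    rw [hext ⟨S, hS⟩]
    exact h2
  rw [hPφ, sub_zero] at h1
  have h2 := hP.norm_eq α
  rw [h1] at h2
  have h3 : P α = 0 := ContinuousLinearMap.ext fun T => by
    have h4 : ‖P α‖ = 0 := le_antisymm (by linarith) (norm_nonneg _)
    have h5 := (P α).le_opNorm T
    rw [h4, zero_mul] at h5
    exact norm_le_zero_iff.1 h5
  rwa [h3, sub_zero] at h1

/-- A weak-star limit of elementary functionals on `L_v(X)` acts on the compact operators as
`S ↦ c · y(S* f)` with `c ∈ 𝕋`, `‖f‖ ≤ 1`, `‖y‖ ≤ 1`, and takes the value `c` at the identity. -/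
theorem exists_of_mem_closure_elementaryL {φ : StrongDual 𝕜 (Lv 𝕜 X)}
    (hφ : StrongDual.toWeakDual φ ∈ closure ((fun φ : StrongDual 𝕜 (Lv 𝕜 X) =>
      StrongDual.toWeakDual φ) '' elementaryL 𝕜 X)) :
    ∃ (c : 𝕜) (f : StrongDual 𝕜 X) (y : StrongDual 𝕜 (StrongDual 𝕜 X)), ‖c‖ = 1 ∧ ‖f‖ ≤ 1 ∧
      ‖y‖ ≤ 1 ∧ φ (idLv 𝕜 X) = c ∧ ∀ S ∈ Kv 𝕜 X, φ S = c * y (f.comp (toOp 𝕜 X S)) := by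
  obtain ⟨V, hV, hVφ⟩ := exists_ultrafilter_of_mem_closure_image hφ
  have hex : ∀ χ : StrongDual 𝕜 (Lv 𝕜 X), ∃ (c : 𝕜) (f : StrongDual 𝕜 X) (x : X),
      χ ∈ elementaryL 𝕜 X → ‖c‖ = 1 ∧ ‖f‖ = 1 ∧ ‖x‖ = 1 ∧ f x = 1 ∧
        ∀ T, χ T = c * f (toOp 𝕜 X T x) := fun χ => by
    by_cases h : χ ∈ elementaryL 𝕜 X
    · obtain ⟨c, hc, p, ⟨h1, h2, h3⟩, hp⟩ := h
      exact ⟨c, p.1, p.2, fun _ => ⟨hc, h1, h2, h3, fun T => LinearMap.congr_fun hp T⟩⟩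
    · exact ⟨0, 0, 0, fun h' => absurd h' h⟩
  choose c f x hcfx using hex
  have hlim : ∀ T, Tendsto (fun χ : StrongDual 𝕜 (Lv 𝕜 X) => χ T) V (𝓝 (φ T)) := fun T =>
    ((WeakDual.eval_continuous T).tendsto _).comp hVφ
  obtain ⟨c₀, hc₀, hcV⟩ := (isCompact_sphere (0 : 𝕜) 1).ultrafilter_le_nhds (V.map c) (by
    rw [le_principal_iff]
    exact mem_map.2 <| mem_of_superset hV fun χ hχ =>
      mem_sphere_zero_iff_norm.2 (hcfx χ hχ).1)
  obtain ⟨f₀, hf₀, hfV⟩ := (WeakDual.isCompact_closedBall (0 : StrongDual 𝕜 X)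
      1).ultrafilter_le_nhds (V.map fun χ => StrongDual.toWeakDual (f χ)) (by
    rw [le_principal_iff]
    exact mem_map.2 <| mem_of_superset hV fun χ hχ => mem_closedBall_zero_iff.2 (hcfx χ hχ).2.1.le)
  obtain ⟨y₀, hy₀, hyV⟩ := (WeakDual.isCompact_closedBall
      (0 : StrongDual 𝕜 (StrongDual 𝕜 X)) 1).ultrafilter_le_nhds
      (V.map fun χ => StrongDual.toWeakDual (incl 𝕜 X (x χ))) (by
    rw [le_principal_iff]
    exact mem_map.2 <| mem_of_superset hV fun χ hχ => mem_closedBall_zero_iff.2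
      ((norm_incl (𝕜 := 𝕜) (x χ)).trans (hcfx χ hχ).2.2.1).le)
  have hc : Tendsto c V (𝓝 c₀) := hcV
  have hf : ∀ z, Tendsto (fun χ => f χ z) V (𝓝 (f₀ z)) := fun z =>
    ((WeakDual.eval_continuous z).tendsto f₀).comp hfV
  have hx : ∀ g : StrongDual 𝕜 X, Tendsto (fun χ => g (x χ)) V (𝓝 (y₀ g)) := fun g =>
    ((WeakDual.eval_continuous g).tendsto y₀).comp hyV
  refine ⟨c₀, WeakDual.toStrongDual f₀, WeakDual.toStrongDual y₀, mem_sphere_zero_iff_norm.1 hc₀,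
    mem_closedBall_zero_iff.1 hf₀, mem_closedBall_zero_iff.1 hy₀, ?_, fun S hS => ?_⟩
  · refine tendsto_nhds_unique (hlim _) (hc.congr' ?_)
    filter_upwards [hV] with χ hχ
    obtain ⟨-, -, -, h1, h2⟩ := hcfx χ hχ
    rw [h2]
    change c χ = c χ * f χ (x χ)
    rw [h1, mul_one]
  · -- along the ultrafilter `S x` converges in norm, because `S` is compact
    obtain ⟨z, hz⟩ := exists_tendsto_of_isCompactOperator (S := toOp 𝕜 X S) hS
      (V := V.map x) (r := 1) (mem_map.2 <| mem_of_superset hV fun χ hχ =>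
        mem_closedBall_zero_iff.2 (hcfx χ hχ).2.2.1.le)
    have hz : Tendsto (fun χ => toOp 𝕜 X S (x χ)) V (𝓝 z) := hz
    have h1 : y₀ ((WeakDual.toStrongDual f₀).comp (toOp 𝕜 X S)) = f₀ z :=
      tendsto_nhds_unique (hx _) (((WeakDual.toStrongDual f₀).continuous.tendsto z).comp hz)
    have h2 : Tendsto (fun χ => f χ (toOp 𝕜 X S (x χ))) V (𝓝 (f₀ z)) := by
      have h3 : Tendsto (fun χ => f χ (toOp 𝕜 X S (x χ)) - f χ z) V (𝓝 0) := by
        refine squeeze_zero_norm' ?_ (tendsto_iff_norm_sub_tendsto_zero.1 hz)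
        filter_upwards [hV] with χ hχ
        rw [← map_sub]
        refine ((f χ).le_opNorm _).trans ?_
        rw [(hcfx χ hχ).2.1, one_mul]
      simpa using h3.add (hf z)
    have h4 : φ S = c₀ * f₀ z := by
      refine tendsto_nhds_unique (hlim S) ((hc.mul h2).congr' ?_)
      filter_upwards [hV] with χ hχ
      exact ((hcfx χ hχ).2.2.2.2 S).symm
    rw [h4, ← h1]
    rfl

/-- An extreme functional on `K_v(X)` is `S ↦ c y(S* f)` for weak-star limits `f` and `y`; that
`(y, f)` belongs to `Π(X*)` follows by evaluating its extension at the identity. -/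
theorem IsCompactLProjection.extremePoints_subset_elementaryK [Nontrivial X] [CompleteSpace X]
    {P : StrongDual 𝕜 (Lv 𝕜 X) →L[𝕜] StrongDual 𝕜 (Lv 𝕜 X)} (hP : IsCompactLProjection P)
    (hn : 0 < numericalIndex 𝕜 X) :
    Set.extremePoints ℝ (Metric.closedBall (0 : StrongDual 𝕜 (Kv 𝕜 X)) 1) ⊆
      elementaryK 𝕜 X := by
  intro ψ hψ
  obtain ⟨φ, hext, hPφ, hφ⟩ := hP.exists_extreme_extension hn hψ
  obtain ⟨c, f, y, hc, hf, hy, hid, hS⟩ :=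
    exists_of_mem_closure_elementaryL (toWeakDual_mem_closure_elementaryL hφ)
  have hR : P (bitensor hn (incl 𝕜 _ f) y) (idLv 𝕜 X) = 0 := by
    rw [← residualOp_apply, hP.residualOp_eq_zero hn]
    rfl
  -- evaluating at the identity shows `y f = 1`
  have h1 : φ - P φ = c • bitensor hn (incl 𝕜 _ f) y - P (c • bitensor hn (incl 𝕜 _ f) y) :=
    hP.sub_apply_eq fun S hSc => by
      rw [hS S hSc, smul_apply, bitensor_incl_apply, smul_eq_mul]
  have h2 := congrArg (fun χ => χ (idLv 𝕜 X)) h1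
  simp only [hPφ, sub_zero, map_smul, sub_apply, smul_apply, hR, mul_zero, hid, bitensor_idLv,
    smul_eq_mul] at h2
  have hc0 : c ≠ 0 := by
    rintro rfl
    simp at hc
  have hyf : y f = 1 := by
    rw [NormedSpace.dual_def] at h2
    exact mul_left_cancel₀ hc0 (by rw [mul_one]; exact h2.symm)
  have h3 : 1 ≤ ‖y‖ * ‖f‖ := by
    have := y.le_opNorm f
    rwa [hyf, norm_one] at this
  have hy1 : ‖y‖ = 1 := le_antisymm hy (by nlinarith [norm_nonneg y])
  have hf1 : ‖f‖ = 1 := le_antisymm hf (by nlinarith [norm_nonneg f])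
  refine ⟨c, hc, (y, f), ⟨hy1, hf1, hyf⟩, LinearMap.ext fun S => ?_⟩
  exact (hext S).symm.trans (hS S S.2)

end ExtremeK

end NumRad

theorem mainTheorem7 {𝕜 : Type*} [RCLike 𝕜] {X : Type*} [NormedAddCommGroup X] [NormedSpace 𝕜 X]
    [CompleteSpace X] [Nontrivial X]
    (hn : 0 < NumRad.numericalIndex 𝕜 X)
    (hM : NumRad.IsMIdeal (NumRad.Kv 𝕜 X)) :
    (∀ ψ ∈ Set.extremePoints ℝ
        (Metric.closedBall (0 : StrongDual 𝕜 (NumRad.Lv 𝕜 X)) 1),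
      StrongDual.toWeakDual ψ ∈
        closure ((fun φ : StrongDual 𝕜 (NumRad.Lv 𝕜 X) => StrongDual.toWeakDual φ) ''
          NumRad.elementaryL 𝕜 X)) ∧
    Set.extremePoints ℝ (Metric.closedBall (0 : StrongDual 𝕜 (NumRad.Kv 𝕜 X)) 1) ⊆
      NumRad.elementaryK 𝕜 X := by
  obtain ⟨-, P, h1, h2, h3⟩ := hM
  exact ⟨fun ψ hψ => NumRad.toWeakDual_mem_closure_elementaryL hψ,
    NumRad.IsCompactLProjection.extremePoints_subset_elementaryK ⟨h1, h2, h3⟩ hn⟩
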